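/- Let $d\ge 1$, $N\ge 0$ and let $U$ be a unitary $d\times d$ matrix. For a unitary matrix $V$ of size $n$, with columns $|v_1\rangle,\dots,|v_n\rangle$, let $\mathcal P_V$ be the von Neumann measurement in the basis $(|v_i\rangle)_i$, regarded as the channel $\mathcal P_V(\sigma)=\sum_i \langle v_i|\sigma|v_i\rangle\,|i\rangle\langle i|$; $\mathcal P_{\mathbb 1}$ denotes the measurement in the computational basis (of $\mathbb C^d$, or of $(\mathbb C^d)^{\otimes N}$ when compared with $\mathcal P_{U^{\otimes N}}$). Let $\|X\|_1=\operatorname{tr}\sqrt{X^\dagger X}$ and, for a linear map $S$ on matrices, $\|S\|_\diamond=\max_{\|X\|_1=1}\|(S\otimes\mathrm{id})(X)\|_1$, where the identity acts on a copy of the input space of $S$. A black box contains $\mathcal P_U$ or $\mathcal P_{\mathbb 1}$, each with probability $1/2$. A quantum network with $N$ queries is an adaptive scheme of the following form: prepare a state of $\mathbb C^d$ and a memory of arbitrary finite dimension; then, $N$ times, send $\mathbb C^d$ through the black box and apply an arbitrary quantum channel to the output of the box and the memory, which yields the next input of the box and the next memory (of arbitrary finite dimension). A final two-outcome POVM on the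 whole output yields the guess. The parallel scheme prepares a state of $(\mathbb C^d)^{\otimes N}\otimes\mathbb C^s$, $s$ arbitrary, applies the $N$ copies of the black box, that is $\mathcal P_{U^{\otimes N}}\otimes\mathrm{id}$ or $\mathcal P_{\mathbb 1}\otimes\mathrm{id}$, and then a two-outcome POVM on the whole output. Then the maximal probability $p_{\mathrm{par}}$ of a correct guess in the parallel scheme exists and equals $$p_{\mathrm{par}}=\tfrac12+\tfrac14\,\|\mathcal P_{U^{\otimes N}}-\mathcal P_{\mathbb 1}\|_\diamond ,$$ and for every quantum network with $N$ queries, and every final two-outcome POVM, the probability of a correct guess is at most $p_{\mathrm{par}}$. Equivalently, if $\sigma_U$ and $\sigma_{\mathbb 1}$ are the output states of any quantum network with $N$ queries when the black box contains $\mathcal P_U$ and $\mathcal P_{\mathbb 1}$ respectively, then $$\|\sigma_U-\sigma_{\mathbb 1}\|_1\le\|\mathcal P_{U^{\otimes N}}-\mathcal P_{\mathbb 1}\|_\diamond .$$ -/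

import Mathlib

open Matrix
open scoped ComplexOrder

namespace QDisc

noncomputable section

/-- A linear map `L(ℂⁿ) → L(ℂᵐ)`, for finite index types `n`, `m`. -/
abbrev SuperOp (n m : Type) : Type :=
  Matrix n n ℂ →ₗ[ℂ] Matrix m m ℂ

/-- The map `Φ ⊗ id` on `L(ℂⁿ) ⊗ L(ℂᵏ) = L(ℂ^(n × k))`: the map `Φ` is applied to each of the
`n × n` blocks of the argument. -/
def ampliate {n m : Type} (k : Type) (Φ : SuperOp n m) : SuperOp (n × k) (m × k) where
  toFun X := Matrix.of fun p q =>
    Φ (Matrix.of fun i j => X (i, p.2) (j, q.2)) p.1 q.1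
  map_add' X Y := by
    ext p q
    exact congrFun (congrFun (Φ.map_add (Matrix.of fun i j => X (i, p.2) (j, q.2))
      (Matrix.of fun i j => Y (i, p.2) (j, q.2))) p.1) q.1
  map_smul' c X := by
    ext p q
    exact congrFun (congrFun (Φ.map_smul c
      (Matrix.of fun i j => X (i, p.2) (j, q.2))) p.1) q.1

/-- Density matrices (quantum states). -/
def IsState {n : Type} [Fintype n] (ρ : Matrix n n ℂ) : Prop :=
  ρ.PosSemidef ∧ ρ.trace = 1

/-- Quantum channels: completely positive and trace-preserving linear maps. -/
structure IsChannel {n m : Type} [Fintype n] [Fintype m] (Φ : SuperOp n m) : Prop where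
  completelyPositive : ∀ (s : ℕ) (X : Matrix (n × Fin s) (n × Fin s) ℂ),
    X.PosSemidef → (ampliate (Fin s) Φ X).PosSemidef
  tracePreserving : ∀ X : Matrix n n ℂ, (Φ X).trace = X.trace

/-- General measurements with finitely many outcomes. -/
def IsPOVM {ι n : Type} [Fintype ι] [DecidableEq n] (M : ι → Matrix n n ℂ) : Prop :=
  (∀ i, (M i).PosSemidef) ∧ ∑ i, M i = 1

/-- The measure-and-prepare map `σ ↦ ∑ i, tr (M i σ) |i⟩⟨i|`. -/
def measureMap {ι n : Type} [DecidableEq ι] [Fintype n] (M : ι → Matrix n n ℂ) : SuperOp n ι where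
  toFun σ := diagonal fun i => (M i * σ).trace
  map_add' σ τ := by
    simp [mul_add, diagonal_add]
  map_smul' c σ := by
    ext i j
    by_cases h : i = j <;> simp [diagonal, h]

/-- The effects `|ψ i⟩⟨ψ i|`, where `ψ i` is the `i`-th column of `U`. -/
def vonNeumannEffects {n : Type} (U : Matrix n n ℂ) (i : n) : Matrix n n ℂ :=
  vecMulVec (fun a => U a i) (star fun a => U a i)

/-- The von Neumann measurement `P_U` in the basis formed by the columns of `U`, as a map with
classical (diagonal) output. -/
def vonNeumann {n : Type} [Fintype n] [DecidableEq n] (U : Matrix n n ℂ) : SuperOp n n :=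
  measureMap (vonNeumannEffects U)

/-- The tensor power `U^{⊗ N}`, acting on `(ℂᵈ)^{⊗ N}` with basis indexed by `Fin N → Fin d`. -/
def tensorPow {d : ℕ} (N : ℕ) (U : Matrix (Fin d) (Fin d) ℂ) :
    Matrix (Fin N → Fin d) (Fin N → Fin d) ℂ :=
  Matrix.of fun i j => ∏ k, U (i k) (j k)

/-- The trace norm `‖X‖₁ = tr √(Xᴴ X)`, that is, the sum of the singular values of `X`. -/
def traceNorm {n : Type} [Fintype n] [DecidableEq n] (X : Matrix n n ℂ) : ℝ :=
  ∑ i, √((posSemidef_conjTranspose_mul_self X).isHermitian.eigenvalues i)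

/-- The diamond norm `max {‖(S ⊗ id) X‖₁ : ‖X‖₁ = 1}`, with the identity acting on an ancilla that
is a copy of the input space. -/
def diamondNorm {n m : Type} [Fintype n] [DecidableEq n] [Fintype m] [DecidableEq m]
    (S : SuperOp n m) : ℝ :=
  sSup {t : ℝ | ∃ X : Matrix (n × n) (n × n) ℂ,
    traceNorm X = 1 ∧ t = traceNorm (ampliate n S X)}

/-- The probability of a correct guess when the state is `σ` or `τ`, each with probability `1/2`,
and the two-outcome measurement `T` is performed: outcome `true` is the guess `σ`, outcome `false`
is the guess `τ`. -/
def guessProb {n : Type} [Fintype n] (T : Bool → Matrix n n ℂ) (σ τ : Matrix n n ℂ) : ℝ :=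
  (1 / 2) * (T true * σ).trace.re + (1 / 2) * (T false * τ).trace.re

/-- A quantum network with `N` open slots, each for a black box that acts on `ℂᵈ`. It consists of
memories `ℂ^(mem k)` of arbitrary finite dimensions, an initial state of the first input of the box
together with the memory, and, for each `k < N`, an arbitrary channel that acts on the output of
the `k`-th use of the box and on the memory, and yields the next input of the box and the next
memory. What follows the last use is the output of the network. -/
structure Network (d N : ℕ) where
  mem : ℕ → ℕ
  init : Matrix (Fin d × Fin (mem 0)) (Fin d × Fin (mem 0)) ℂ
  isState_init : IsState init
  process : ∀ k : ℕ, SuperOp (Fin d × Fin (mem k)) (Fin d × Fin (mem (k + 1)))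
  isChannel_process : ∀ k < N, IsChannel (process k)

/-- The joint state of the box's register and the memory after `k` rounds, each of which is a use
of the black box `Φ` followed by a processing channel. -/
def Network.stateAfter {d N : ℕ} (W : Network d N) (Φ : SuperOp (Fin d) (Fin d)) :
    ∀ k : ℕ, Matrix (Fin d × Fin (W.mem k)) (Fin d × Fin (W.mem k)) ℂ
  | 0 => W.init
  | k + 1 => W.process k (ampliate (Fin (W.mem k)) Φ (W.stateAfter Φ k))

/-- The output of the network after all its `N` queries to the black box `Φ`. -/
def Network.output {d N : ℕ} (W : Network d N) (Φ : SuperOp (Fin d) (Fin d)) :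
    Matrix (Fin d × Fin (W.mem N)) (Fin d × Fin (W.mem N)) ℂ :=
  W.stateAfter Φ N

/-- The probabilities of correct discrimination between `P_U` and `P_1` that are attained by
networks with `N` queries, followed by a two-outcome measurement. -/
def networkProbs {d : ℕ} (N : ℕ) (U : Matrix (Fin d) (Fin d) ℂ) : Set ℝ :=
  {p | ∃ (W : Network d N)
      (T : Bool → Matrix (Fin d × Fin (W.mem N)) (Fin d × Fin (W.mem N)) ℂ),
    IsPOVM T ∧ p = guessProb T (W.output (vonNeumann U)) (W.output (vonNeumann 1))}

/-- The probabilities of correct discrimination between `P_U` and `P_1` that are attained by the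
parallel scheme: a state of `(ℂᵈ)^{⊗ N}` and an ancilla of arbitrary finite dimension is prepared,
`N` copies of the black box act on `(ℂᵈ)^{⊗ N}`, and a two-outcome measurement is performed. -/
def parallelProbs {d : ℕ} (N : ℕ) (U : Matrix (Fin d) (Fin d) ℂ) : Set ℝ :=
  {p | ∃ (s : ℕ) (ρ : Matrix ((Fin N → Fin d) × Fin s) ((Fin N → Fin d) × Fin s) ℂ)
      (T : Bool → Matrix ((Fin N → Fin d) × Fin s) ((Fin N → Fin d) × Fin s) ℂ),
    IsState ρ ∧ IsPOVM T ∧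
      p = guessProb T (ampliate (Fin s) (vonNeumann (tensorPow N U)) ρ)
        (ampliate (Fin s) (vonNeumann 1) ρ)}

end

end QDisc

/-!
Up to a common dephasing, the measurement `P_V` is the rotation by `Vᴴ`, and `V` may be replaced by
`V * diagonal e` for arbitrary phases `e`. For a unitary matrix `W` let `c(W)` be the minimum, over
all states `ρ`, of `∑ i, |(ρ W) i i|`, the fidelity of the outputs of `P_W` and `P_1` on one half of
a purification of `ρ` (`boxFidelity`). Everything is expressed through this number:
`‖P_W - P_1‖_⋄ = 2 √(1 - c(W)²)`.

The upper bound rests on the choice of phases. If `c = c(W) > 0`, a separating hyperplane gives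
phases such that `V = W * diagonal e` satisfies `Re ⟨a, V a⟩ ≥ c ‖a‖²` (`exists_phases`), so that
`V` rotates every vector, with or without an ancilla, by at most the angle `θ = arccos c`. The bound
is attained because, at a minimiser, the equality conditions provide two states with the same
diagonal on the eigenspaces of `V` for `exp (± i θ)` (`exists_eigenstates`). The outputs of the two
boxes on a purification of their even mixture are block diagonal, and in each block they are two
vectors of equal length at the angle `θ` (`exists_isState_le_traceNorm`). If `c = 0`, a purification
of the minimiser itself is discriminated perfectly.

In a network, all that differs between the two boxes is a rotation by an angle of at most `θ` in
each query; the remaining maps are channels, which do not increase the angle between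
purifications. By the triangle inequality for angles the outputs are at an angle of at most `N θ`
(`angleLE_stateAfter`), where `cos θ = c(U)`.

It remains to see that `N` parallel queries do as well, that is, that `c(U^{⊗ N})` is at most
`cos (N θ)`, or zero if `N θ > π / 2`. All products of the two eigenstates for `U` have the same
diagonal, and their overlaps with the rotated states are `exp (i (N - 2 k) θ)`; convex combinations
of these numbers contain `cos (N θ)`, and zero as soon as `N θ` exceeds `π / 2`
(`overlapReachable_of_pi_div_two_lt`). The comparison is made in `traceNorm_output_sub_le`.
-/

namespace QDisc

/-! ### The Hilbert–Schmidt inner product -/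

section HilbertSchmidt

variable {n m e k : Type} [Fintype n] [Fintype m] [Fintype e] [Fintype k]

/-- The real part of the Hilbert–Schmidt inner product `tr (Aᴴ B)`. -/
noncomputable def hsRe (A B : Matrix n e ℂ) : ℝ := (Aᴴ * B).trace.re

/-- The entries of a matrix as a vector of a Hilbert space, whose real inner product is `hsRe`. -/
noncomputable def hsVec (A : Matrix n e ℂ) : EuclideanSpace ℂ (n × e) :=
  WithLp.toLp 2 fun p => A p.1 p.2

lemma inner_hsVec (A B : Matrix n e ℂ) : inner ℝ (hsVec A) (hsVec B) = hsRe A B := by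
  simp only [hsVec, hsRe, PiLp.inner_apply, trace, diag, mul_apply, conjTranspose_apply,
    Fintype.sum_prod_type, Complex.re_sum]
  rw [Finset.sum_comm]
  simp [Complex.inner, mul_comm]

lemma hsRe_self_nonneg (A : Matrix n e ℂ) : 0 ≤ hsRe A A := by
  rw [← inner_hsVec]; exact real_inner_self_nonneg

lemma hsRe_le_sqrt_mul_sqrt (A B : Matrix n e ℂ) : hsRe A B ≤ √(hsRe A A) * √(hsRe B B) := by
  have h := real_inner_le_norm (hsVec A) (hsVec B)
  rwa [norm_eq_sqrt_real_inner, norm_eq_sqrt_real_inner, inner_hsVec, inner_hsVec,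
    inner_hsVec] at h

lemma hsRe_comm (A B : Matrix n e ℂ) : hsRe A B = hsRe B A := by
  rw [← inner_hsVec, real_inner_comm, inner_hsVec]

lemma hsRe_add_left (A B C : Matrix n e ℂ) : hsRe (A + B) C = hsRe A C + hsRe B C := by
  simp [hsRe, Matrix.add_mul]

lemma hsRe_sub_left (A B C : Matrix n e ℂ) : hsRe (A - B) C = hsRe A C - hsRe B C := by
  simp [hsRe, Matrix.sub_mul]

lemma hsRe_add_right (A B C : Matrix n e ℂ) : hsRe A (B + C) = hsRe A B + hsRe A C := by
  simp [hsRe, Matrix.mul_add]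

lemma hsRe_sub_right (A B C : Matrix n e ℂ) : hsRe A (B - C) = hsRe A B - hsRe A C := by
  simp [hsRe, Matrix.mul_sub]

/-- The triangle inequality for the angle between unit vectors. -/
lemma arccos_hsRe_triangle {A B C : Matrix n e ℂ} (hA : hsRe A A = 1) (hB : hsRe B B = 1)
    (hC : hsRe C C = 1) :
    Real.arccos (hsRe A C) ≤ Real.arccos (hsRe A B) + Real.arccos (hsRe B C) := by
  have key := InnerProductGeometry.angle_le_angle_add_angle (hsVec A) (hsVec B) (hsVec C)
  have norm1 : ∀ {A : Matrix n e ℂ}, hsRe A A = 1 → ‖hsVec A‖ = 1 := fun {A} h => by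
    rw [norm_eq_sqrt_real_inner, inner_hsVec, h, Real.sqrt_one]
  simpa [InnerProductGeometry.angle, inner_hsVec, norm1 hA, norm1 hB, norm1 hC] using key

variable [DecidableEq n] [DecidableEq m] [DecidableEq k]

lemma trace_mul_mul_conjTranspose_le {M : Matrix n n ℂ} (hM : (1 - M * Mᴴ).PosSemidef)
    (A B : Matrix n e ℂ) :
    (M * (A * Bᴴ)).trace.re ≤ √(hsRe A A) * √(hsRe B B) := by
  have h1 : (M * (A * Bᴴ)).trace.re = hsRe (Mᴴ * B) A := by
    rw [hsRe, conjTranspose_mul, conjTranspose_conjTranspose, ← Matrix.mul_assoc,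
      Matrix.trace_mul_comm, Matrix.mul_assoc]
  have h2 : hsRe (Mᴴ * B) (Mᴴ * B) ≤ hsRe B B := by
    have h := (hM.conjTranspose_mul_mul_same B).trace_nonneg
    have h' := (Complex.le_def.1 h).1
    rw [Matrix.mul_sub, Matrix.sub_mul, Matrix.mul_one, trace_sub, Complex.sub_re] at h'
    simp only [hsRe, conjTranspose_mul, conjTranspose_conjTranspose, Matrix.mul_assoc] at h' ⊢
    simp at h'
    linarith
  rw [h1, mul_comm]
  exact (hsRe_le_sqrt_mul_sqrt _ _).trans
    (mul_le_mul_of_nonneg_right (Real.sqrt_le_sqrt h2) (Real.sqrt_nonneg _))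

end HilbertSchmidt

/-! ### The trace norm -/

section TraceNorm

variable {n m e : Type} [Fintype n] [Fintype m] [Fintype e] [DecidableEq n] [DecidableEq m]

lemma exists_unitary_diagonalization {A : Matrix n n ℂ} (hA : A.IsHermitian) :
    ∃ Q : Matrix n n ℂ, Qᴴ * Q = 1 ∧ Q * Qᴴ = 1 ∧
      A = Q * diagonal (fun i => (hA.eigenvalues i : ℂ)) * Qᴴ := by
  refine ⟨hA.eigenvectorUnitary, ?_, ?_, ?_⟩
  · exact Unitary.coe_star_mul_self _
  · exact Unitary.coe_mul_star_self _
  · have h := hA.spectral_theorem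
    rw [Unitary.conjStarAlgAut_apply] at h
    exact h

lemma exists_eq_mul_conjTranspose_self {A : Matrix n n ℂ} (hA : A.PosSemidef) :
    ∃ B : Matrix n n ℂ, A = B * Bᴴ := by
  obtain ⟨Q, hQ1, hQ2, hX⟩ := exists_unitary_diagonalization hA.isHermitian
  refine ⟨Q * diagonal fun i => ((√(hA.isHermitian.eigenvalues i) : ℝ) : ℂ), ?_⟩
  have hl : ∀ i, 0 ≤ hA.isHermitian.eigenvalues i := hA.eigenvalues_nonneg
  have hd : diagonal (fun i => (hA.isHermitian.eigenvalues i : ℂ)) =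
      diagonal (fun i => ((√(hA.isHermitian.eigenvalues i) : ℝ) : ℂ)) *
        (diagonal (fun i => ((√(hA.isHermitian.eigenvalues i) : ℝ) : ℂ)))ᴴ := by
    rw [diagonal_conjTranspose, diagonal_mul_diagonal]
    congr 1; ext i
    simp only [Pi.star_apply, RCLike.star_def, Complex.conj_ofReal]
    rw [← Complex.ofReal_mul, Real.mul_self_sqrt (hl i)]
  rw [conjTranspose_mul, Matrix.mul_assoc Q, ← Matrix.mul_assoc _ _ Qᴴ, ← hd,
    ← Matrix.mul_assoc, ← hX]

lemma traceNorm_nonneg (X : Matrix n n ℂ) : 0 ≤ traceNorm X :=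
  Finset.sum_nonneg fun _ _ => Real.sqrt_nonneg _

/-- The singular value decomposition of `X`, with the singular values split evenly between the two
factors. -/
lemma exists_eq_mul_conjTranspose (X : Matrix n n ℂ) :
    ∃ A B : Matrix n n ℂ, X = A * Bᴴ ∧ hsRe A A = traceNorm X ∧ hsRe B B = traceNorm X := by
  have hP := posSemidef_conjTranspose_mul_self X
  obtain ⟨Q, hQ1, hQ2, hX⟩ := exists_unitary_diagonalization hP.isHermitian
  have hl : ∀ i, 0 ≤ hP.isHermitian.eigenvalues i := hP.eigenvalues_nonneg
  set l := hP.isHermitian.eigenvalues with hl_def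
  have hYY : (X * Q)ᴴ * (X * Q) = diagonal fun i => (l i : ℂ) := by
    rw [conjTranspose_mul, Matrix.mul_assoc, ← Matrix.mul_assoc Xᴴ, hX]
    simp only [Matrix.mul_assoc, hQ1, Matrix.mul_one]
    rw [← Matrix.mul_assoc, hQ1, Matrix.one_mul]
  let r : n → ℝ := fun i => √(√(l i))
  -- a column of `X * Q` vanishes where `r` does, so the junk value `0⁻¹ = 0` is harmless
  have hcol : X * Q * diagonal (fun i => ((r i)⁻¹ : ℂ)) * diagonal (fun i => (r i : ℂ)) =
      X * Q := by
    rw [Matrix.mul_assoc, diagonal_mul_diagonal]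
    ext i j
    rw [mul_diagonal]
    by_cases h : r j = 0
    · have hlj : l j = 0 := by
        have := Real.sqrt_eq_zero (Real.sqrt_nonneg _) |>.1 h
        exact (Real.sqrt_eq_zero (hl j)).1 this
      have h0 : ((X * Q)ᴴ * (X * Q)) j j = 0 := by rw [hYY]; simp [hlj]
      have : ∑ a, ‖(X * Q) a j‖ ^ 2 = 0 := by
        have h1 : ((X * Q)ᴴ * (X * Q)) j j = ((∑ a, ‖(X * Q) a j‖ ^ 2 : ℝ) : ℂ) := by
          rw [mul_apply]
          push_cast
          exact Finset.sum_congr rfl fun a _ => by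
            rw [conjTranspose_apply]; exact Complex.conj_mul' _
        rw [h1] at h0
        exact_mod_cast h0
      have h2 := (Finset.sum_eq_zero_iff_of_nonneg fun a _ => by positivity).1 this i
        (Finset.mem_univ i)
      have h3 : (X * Q) i j = 0 := by simpa using h2
      rw [h3, zero_mul]
    · have : (r j : ℂ) ≠ 0 := by exact_mod_cast h
      rw [inv_mul_cancel₀ this, mul_one]
  have hr2 : ∀ i, r i * r i = √(l i) := fun i => Real.mul_self_sqrt (Real.sqrt_nonneg _)
  have hcA : (diagonal fun i => ((r i)⁻¹ : ℂ))ᴴ = diagonal fun i => ((r i)⁻¹ : ℂ) := by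
    rw [diagonal_conjTranspose]; congr 1; ext i; simp
  have hcB : (diagonal fun i => (r i : ℂ))ᴴ = diagonal fun i => (r i : ℂ) := by
    rw [diagonal_conjTranspose]; congr 1; ext i; simp
  refine ⟨X * Q * diagonal (fun i => ((r i)⁻¹ : ℂ)), Q * diagonal (fun i => (r i : ℂ)),
    ?_, ?_, ?_⟩
  · rw [conjTranspose_mul, hcB, ← Matrix.mul_assoc, hcol, Matrix.mul_assoc, hQ2, Matrix.mul_one]
  · rw [hsRe, conjTranspose_mul, hcA, Matrix.mul_assoc, ← Matrix.mul_assoc (X * Q)ᴴ, hYY,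
      diagonal_mul_diagonal, diagonal_mul_diagonal, trace_diagonal, Complex.re_sum, traceNorm]
    refine Finset.sum_congr rfl fun i _ => ?_
    have : ((r i)⁻¹ : ℂ) * ((l i : ℂ) * ((r i)⁻¹ : ℂ)) = (((r i)⁻¹ * (l i * (r i)⁻¹) : ℝ) : ℂ) := by
      push_cast; rfl
    rw [this, Complex.ofReal_re]
    by_cases h : r i = 0
    · have : √(l i) = 0 := by rw [← hr2, h, mul_zero]
      rw [this, h]; simp
    · have : l i = (r i * r i) * (r i * r i) := by rw [hr2, Real.mul_self_sqrt (hl i)]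
      rw [← hl_def, ← hr2]
      nth_rewrite 1 [this]
      field_simp
  · rw [hsRe, conjTranspose_mul, hcB, Matrix.mul_assoc, ← Matrix.mul_assoc Qᴴ, hQ1,
      Matrix.one_mul, diagonal_mul_diagonal, trace_diagonal, Complex.re_sum, traceNorm]
    refine Finset.sum_congr rfl fun i _ => ?_
    rw [← hl_def, ← hr2, ← Complex.ofReal_mul, Complex.ofReal_re]

/-- Hölder's inequality for the trace norm and a contraction. -/
lemma trace_mul_le_traceNorm {M : Matrix n n ℂ} (hM : (1 - M * Mᴴ).PosSemidef)
    (X : Matrix n n ℂ) : (M * X).trace.re ≤ traceNorm X := by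
  obtain ⟨A, B, hX, hA, hB⟩ := exists_eq_mul_conjTranspose X
  have h := trace_mul_mul_conjTranspose_le hM A B
  rwa [hA, hB, ← hX, Real.mul_self_sqrt (traceNorm_nonneg X)] at h

open scoped MatrixOrder in
/-- If `Z = |X|`, then the trace norm of `X` is the trace of `Z`. -/
lemma traceNorm_eq_trace {X Z : Matrix n n ℂ} (hZ : Z.PosSemidef) (h : Z * Z = Xᴴ * X) :
    traceNorm X = Z.trace.re := by
  have hP := posSemidef_conjTranspose_mul_self X
  obtain ⟨Q, hQ1, hQ2, hX⟩ := exists_unitary_diagonalization hP.isHermitian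
  have hl : ∀ i, 0 ≤ hP.isHermitian.eigenvalues i := hP.eigenvalues_nonneg
  set l := hP.isHermitian.eigenvalues with hl_def
  set Y : Matrix n n ℂ := Q * diagonal (fun i => ((√(l i) : ℝ) : ℂ)) * Qᴴ with hY
  have hYp : Y.PosSemidef := by
    refine PosSemidef.mul_mul_conjTranspose_same (PosSemidef.diagonal fun i => ?_) Q
    simp [Real.sqrt_nonneg]
  have hYY : Y * Y = Xᴴ * X := by
    rw [hX, hY]
    simp only [Matrix.mul_assoc]
    rw [← Matrix.mul_assoc Qᴴ, hQ1, Matrix.one_mul, ← Matrix.mul_assoc (diagonal _),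
      diagonal_mul_diagonal]
    congr 3
    ext i
    rw [← Complex.ofReal_mul, Real.mul_self_sqrt (hl i)]
  have hYZ : Y = Z := by
    rw [← CFC.sqrt_unique hYY (nonneg_iff_posSemidef.2 hYp),
      ← CFC.sqrt_unique h (nonneg_iff_posSemidef.2 hZ)]
  rw [← hYZ, hY, Matrix.trace_mul_comm, ← Matrix.mul_assoc, hQ1, Matrix.one_mul, trace_diagonal,
    Complex.re_sum, traceNorm]
  simp [hl_def]

lemma traceNorm_of_posSemidef {X : Matrix n n ℂ} (hX : X.PosSemidef) :
    traceNorm X = X.trace.re :=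
  traceNorm_eq_trace hX (by rw [hX.isHermitian.eq])

/-- The trace norm is attained by pairing with a contraction. -/
lemma exists_contraction_traceNorm (X : Matrix n n ℂ) :
    ∃ M : Matrix n n ℂ, (1 - M * Mᴴ).PosSemidef ∧ (M * X).trace.re = traceNorm X := by
  have hP := posSemidef_conjTranspose_mul_self X
  obtain ⟨Q, hQ1, hQ2, hX⟩ := exists_unitary_diagonalization hP.isHermitian
  have hl : ∀ i, 0 ≤ hP.isHermitian.eigenvalues i := hP.eigenvalues_nonneg
  set l := hP.isHermitian.eigenvalues with hl_def
  let D : Matrix n n ℂ := diagonal fun i => (((√(l i))⁻¹ : ℝ) : ℂ)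
  have hD : Dᴴ = D := by
    simp only [D]; rw [diagonal_conjTranspose]; congr 1; ext i; simp
  have hDl : D * diagonal (fun i => (l i : ℂ)) = diagonal fun i => ((√(l i) : ℝ) : ℂ) := by
    simp only [D]
    rw [diagonal_mul_diagonal]
    congr 1; ext i
    rw [← Complex.ofReal_mul]
    congr 1
    by_cases h : √(l i) = 0
    · rw [h]; simp
    · nth_rewrite 2 [← Real.mul_self_sqrt (hl i)]
      field_simp
  refine ⟨Q * D * Qᴴ * Xᴴ, ?_, ?_⟩
  · have h1 : Q * D * Qᴴ * Xᴴ * (Q * D * Qᴴ * Xᴴ)ᴴ =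
        Q * (D * diagonal (fun i => (l i : ℂ)) * D) * Qᴴ := by
      simp only [conjTranspose_mul, conjTranspose_conjTranspose, hD]
      rw [Matrix.mul_assoc (Q * D * Qᴴ), ← Matrix.mul_assoc Xᴴ, hX]
      simp only [Matrix.mul_assoc]
      rw [← Matrix.mul_assoc Qᴴ, hQ1, Matrix.one_mul, ← Matrix.mul_assoc Qᴴ, hQ1, Matrix.one_mul]
    have h2 : 1 - Q * D * Qᴴ * Xᴴ * (Q * D * Qᴴ * Xᴴ)ᴴ =
        Q * (1 - D * diagonal (fun i => (l i : ℂ)) * D) * Qᴴ := by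
      rw [h1, Matrix.mul_sub, Matrix.sub_mul, Matrix.mul_one, hQ2]
    rw [h2, hDl]
    refine PosSemidef.mul_mul_conjTranspose_same ?_ Q
    simp only [D]
    rw [diagonal_mul_diagonal, ← diagonal_one, diagonal_sub]
    refine PosSemidef.diagonal fun i => ?_
    simp only [Pi.zero_apply]
    rw [← Complex.ofReal_mul]
    by_cases h : √(l i) = 0
    · rw [h]; simp
    · rw [mul_inv_cancel₀ h]; simp
  · have h1 : Q * D * Qᴴ * Xᴴ * X = Q * (D * diagonal (fun i => (l i : ℂ))) * Qᴴ := by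
      rw [Matrix.mul_assoc, hX]
      simp only [Matrix.mul_assoc]
      rw [← Matrix.mul_assoc Qᴴ, hQ1, Matrix.one_mul]
    rw [h1, hDl, Matrix.trace_mul_comm, ← Matrix.mul_assoc, hQ1, Matrix.one_mul, trace_diagonal,
      Complex.re_sum, traceNorm]
    simp [hl_def]

/-- For a Hermitian matrix, the trace norm is attained by pairing with its sign. -/
lemma exists_hermitian_traceNorm {X : Matrix n n ℂ} (hX : X.IsHermitian) :
    ∃ M : Matrix n n ℂ, M.IsHermitian ∧ M * M = 1 ∧ (M * X).trace.re = traceNorm X := by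
  obtain ⟨Q, hQ1, hQ2, hXQ⟩ := exists_unitary_diagonalization hX
  set l := hX.eigenvalues with hl_def
  let s : n → ℝ := fun i => if 0 ≤ l i then 1 else -1
  have hs1 : ∀ i, s i * s i = 1 := fun i => by simp only [s]; split_ifs <;> norm_num
  have hs2 : ∀ i, s i * l i = |l i| := fun i => by
    simp only [s]; split_ifs with h
    · rw [one_mul, abs_of_nonneg h]
    · rw [abs_of_neg (not_le.1 h)]; ring
  have hsl : (diagonal fun i => (s i : ℂ)) * diagonal (fun i => (l i : ℂ)) =
      diagonal fun i => ((|l i| : ℝ) : ℂ) := by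
    rw [diagonal_mul_diagonal]; congr 1; ext i; rw [← Complex.ofReal_mul, hs2]
  refine ⟨Q * diagonal (fun i => (s i : ℂ)) * Qᴴ, ?_, ?_, ?_⟩
  · rw [IsHermitian, conjTranspose_mul, conjTranspose_mul, conjTranspose_conjTranspose,
      diagonal_conjTranspose, Matrix.mul_assoc]
    congr 3; ext i; simp
  · simp only [Matrix.mul_assoc]
    rw [← Matrix.mul_assoc Qᴴ, hQ1, Matrix.one_mul, ← Matrix.mul_assoc (diagonal _),
      diagonal_mul_diagonal]
    have : (fun i => (s i : ℂ) * (s i : ℂ)) = fun _ => 1 := by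
      ext i; rw [← Complex.ofReal_mul, hs1, Complex.ofReal_one]
    rw [this, diagonal_one, Matrix.one_mul, hQ2]
  · have hprod : Q * diagonal (fun i => (s i : ℂ)) * Qᴴ * X =
        Q * diagonal (fun i => ((|l i| : ℝ) : ℂ)) * Qᴴ := by
      nth_rewrite 1 [hXQ]
      simp only [Matrix.mul_assoc]
      rw [← Matrix.mul_assoc Qᴴ, hQ1, Matrix.one_mul, ← Matrix.mul_assoc (diagonal _), hsl]
    have hpos : (Q * diagonal (fun i => ((|l i| : ℝ) : ℂ)) * Qᴴ).PosSemidef :=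
      PosSemidef.mul_mul_conjTranspose_same (PosSemidef.diagonal fun i => by simp) Q
    rw [hprod]
    refine (traceNorm_eq_trace hpos ?_).symm
    rw [hX.eq]
    have conj_mul : ∀ E F : Matrix n n ℂ, Q * E * Qᴴ * (Q * F * Qᴴ) = Q * (E * F) * Qᴴ := by
      intro E F
      simp only [Matrix.mul_assoc]
      rw [← Matrix.mul_assoc Qᴴ, hQ1, Matrix.one_mul]
    have hXX : X * X =
        Q * (diagonal (fun i => (l i : ℂ)) * diagonal (fun i => (l i : ℂ))) * Qᴴ := by
      rw [← conj_mul, ← hXQ]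
    rw [hXX, conj_mul, diagonal_mul_diagonal, diagonal_mul_diagonal]
    congr 3; ext i
    rw [← Complex.ofReal_mul, ← Complex.ofReal_mul, abs_mul_abs_self]

/-- The trace-norm distance of `A' * B'ᴴ` and `A * Bᴴ` in terms of overlaps. When `A' = B'` and
`A = B`, this is the bound `2 * √(1 - F ^ 2)` by the fidelity. -/
lemma traceNorm_sub_le {A A' B B' : Matrix n e ℂ} (hA : hsRe A A = 1) (hA' : hsRe A' A' = 1)
    (hB : hsRe B B = 1) (hB' : hsRe B' B' = 1) :
    traceNorm (A' * B'ᴴ - A * Bᴴ) ≤ √(4 - (hsRe A' A + hsRe B' B) ^ 2) := by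
  obtain ⟨M, hM, hMX⟩ := exists_contraction_traceNorm (A' * B'ᴴ - A * Bᴴ)
  have h1 := trace_mul_mul_conjTranspose_le hM (A' - A) (B' + B)
  have h2 := trace_mul_mul_conjTranspose_le hM (A' + A) (B' - B)
  have h3 : 2 * (M * (A' * B'ᴴ - A * Bᴴ)).trace.re =
      (M * ((A' - A) * (B' + B)ᴴ)).trace.re + (M * ((A' + A) * (B' - B)ᴴ)).trace.re := by
    simp only [conjTranspose_add, conjTranspose_sub, Matrix.mul_add, Matrix.mul_sub,
      Matrix.add_mul, Matrix.sub_mul, trace_add, trace_sub, Complex.add_re, Complex.sub_re]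
    ring
  have e1 : hsRe (A' - A) (A' - A) = 2 - 2 * hsRe A' A := by
    simp only [hsRe_sub_left, hsRe_sub_right, hA, hA', hsRe_comm A A']; ring
  have e2 : hsRe (A' + A) (A' + A) = 2 + 2 * hsRe A' A := by
    simp only [hsRe_add_left, hsRe_add_right, hA, hA', hsRe_comm A A']; ring
  have e3 : hsRe (B' - B) (B' - B) = 2 - 2 * hsRe B' B := by
    simp only [hsRe_sub_left, hsRe_sub_right, hB, hB', hsRe_comm B B']; ring
  have e4 : hsRe (B' + B) (B' + B) = 2 + 2 * hsRe B' B := by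
    simp only [hsRe_add_left, hsRe_add_right, hB, hB', hsRe_comm B B']; ring
  have p1 := hsRe_self_nonneg (A' - A)
  have p2 := hsRe_self_nonneg (A' + A)
  have p3 := hsRe_self_nonneg (B' - B)
  have p4 := hsRe_self_nonneg (B' + B)
  rw [e1, e4] at h1
  rw [e2, e3] at h2
  rw [e1] at p1; rw [e2] at p2; rw [e3] at p3; rw [e4] at p4
  rw [← hMX]
  set a := hsRe A' A
  set b := hsRe B' B
  -- Cauchy–Schwarz in the plane for the two products of norms
  refine Real.le_sqrt_of_sq_le ?_
  have hnn : 0 ≤ (M * (A' * B'ᴴ - A * Bᴴ)).trace.re := by rw [hMX]; exact traceNorm_nonneg _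
  have s1 := Real.sq_sqrt p1
  have s2 := Real.sq_sqrt p2
  have s3 := Real.sq_sqrt p3
  have s4 := Real.sq_sqrt p4
  set x := √(2 - 2 * a)
  set y := √(2 + 2 * a)
  set z := √(2 - 2 * b)
  set w := √(2 + 2 * b)
  set t := (M * (A' * B'ᴴ - A * Bᴴ)).trace.re
  have ht : 2 * t ≤ x * w + y * z := by linarith
  have hsq : (2 * t) ^ 2 ≤ (x * w + y * z) ^ 2 := pow_le_pow_left₀ (by linarith) ht 2
  have hcs : (x * w + y * z) ^ 2 ≤ (x ^ 2 + z ^ 2) * (w ^ 2 + y ^ 2) := by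
    nlinarith [sq_nonneg (x * y - z * w)]
  rw [s1, s2, s3, s4] at hcs
  nlinarith

/-- If the columns of `K` and of `L` have the same diagonal Gram matrix `G` of trace one, and the
mutual Gram matrix of `K` and `L` is `c • G`, the distance of `K * Kᴴ` and `L * Lᴴ` is that of two
pure states with overlap `c`. -/
lemma traceNorm_sub_of_gram {K L : Matrix n e ℂ} {G : Matrix e e ℂ} {c : ℝ} (hc : c ^ 2 ≤ 1)
    (hK : Kᴴ * K = G) (hL : Lᴴ * L = G) (hKL : Kᴴ * L = (c : ℂ) • G)
    (hLK : Lᴴ * K = (c : ℂ) • G) (hG : G.trace = 1) :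
    2 * √(1 - c ^ 2) ≤ traceNorm (K * Kᴴ - L * Lᴴ) := by
  rcases hc.eq_or_lt with hc1 | hc1
  · rw [hc1, sub_self, Real.sqrt_zero, mul_zero]
    exact traceNorm_nonneg _
  set s := √(1 - c ^ 2) with hs_def
  have hs : 0 < s := Real.sqrt_pos.2 (by linarith)
  have hs2 : s ^ 2 = 1 - c ^ 2 := Real.sq_sqrt (by linarith)
  have hsC : (s : ℂ) ≠ 0 := by exact_mod_cast hs.ne'
  have hs2C : (s : ℂ) ^ 2 = 1 - (c : ℂ) ^ 2 := by exact_mod_cast hs2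
  -- `Z` is the absolute value of `K * Kᴴ - L * Lᴴ`
  set Z : Matrix n n ℂ := ((s⁻¹ : ℝ) : ℂ) • (K * Kᴴ + L * Lᴴ - (c : ℂ) • (K * Lᴴ + L * Kᴴ)) with hZ
  have hZp : Z.PosSemidef := by
    refine PosSemidef.smul ?_ (by simpa using hs.le)
    have : K * Kᴴ + L * Lᴴ - (c : ℂ) • (K * Lᴴ + L * Kᴴ) =
        (K - (c : ℂ) • L) * (K - (c : ℂ) • L)ᴴ + ((s ^ 2 : ℝ) : ℂ) • (L * Lᴴ) := by
      have hcc : star (c : ℂ) = c := Complex.conj_ofReal c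
      push_cast
      rw [hs2C]
      simp only [conjTranspose_sub, conjTranspose_smul, hcc, Matrix.sub_mul, Matrix.mul_sub,
        Matrix.smul_mul, Matrix.mul_smul]
      module
    rw [this]
    exact (posSemidef_self_mul_conjTranspose _).add
      ((posSemidef_self_mul_conjTranspose _).smul (by exact_mod_cast sq_nonneg s))
  have hsq : Z * Z = (K * Kᴴ - L * Lᴴ)ᴴ * (K * Kᴴ - L * Lᴴ) := by
    have prod : ∀ {A B C D : Matrix n e ℂ}, A * Bᴴ * (C * Dᴴ) = A * (Bᴴ * C) * Dᴴ := by
      intros; simp only [Matrix.mul_assoc]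
    have hH : (K * Kᴴ - L * Lᴴ)ᴴ = K * Kᴴ - L * Lᴴ := by simp
    rw [hH, hZ]
    simp only [Matrix.smul_mul, Matrix.mul_smul, Matrix.mul_sub, Matrix.sub_mul, Matrix.mul_add,
      Matrix.add_mul, smul_add, smul_sub, prod, hK, hL, hKL, hLK]
    push_cast
    match_scalars <;> (field_simp; rw [hs2C]; ring)
  rw [traceNorm_eq_trace hZp hsq, hZ, trace_smul, trace_sub, trace_smul, trace_add, trace_add,
    Matrix.trace_mul_comm K, Matrix.trace_mul_comm L, Matrix.trace_mul_comm K,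
    Matrix.trace_mul_comm L, hK, hL, hKL, hLK, trace_smul, hG]
  refine le_of_eq ?_
  have : ((s⁻¹ : ℝ) : ℂ) • ((1 : ℂ) + 1 - (c : ℂ) • ((c : ℂ) • (1 : ℂ) + (c : ℂ) • (1 : ℂ))) =
      ((s⁻¹ * (2 * s ^ 2) : ℝ) : ℂ) := by
    simp only [smul_eq_mul, hs2]; push_cast; ring
  rw [this, Complex.ofReal_re]
  field_simp

/-- Orthogonal positive semidefinite matrices are perfectly distinguishable. -/
lemma traceNorm_sub_of_mul_eq_zero {σ τ : Matrix n n ℂ} (hσ : σ.PosSemidef) (hτ : τ.PosSemidef)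
    (h : σ * τ = 0) : traceNorm (σ - τ) = (σ + τ).trace.re := by
  have h' : τ * σ = 0 := by
    have := congrArg conjTranspose h
    rwa [conjTranspose_mul, hσ.isHermitian.eq, hτ.isHermitian.eq, conjTranspose_zero] at this
  refine traceNorm_eq_trace (hσ.add hτ) ?_
  rw [conjTranspose_sub, hσ.isHermitian.eq, hτ.isHermitian.eq]
  simp [Matrix.mul_sub, Matrix.sub_mul, Matrix.mul_add, Matrix.add_mul, h, h']

end TraceNorm

/-! ### Kraus operators -/

section Kraus

variable {n m e r : Type} [Fintype n] [Fintype e] [Fintype r]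

/-- The Kraus operators `K a` applied to `A` and written side by side, so that
`kraus K A * (kraus K B)ᴴ = ∑ a, K a * (A * Bᴴ) * (K a)ᴴ`. -/
def kraus (K : r → Matrix m n ℂ) (A : Matrix n e ℂ) : Matrix m (e × r) ℂ :=
  Matrix.of fun p q => (K q.2 * A) p q.1

lemma kraus_mul_conjTranspose (K : r → Matrix m n ℂ) (A B : Matrix n e ℂ) :
    kraus K A * (kraus K B)ᴴ = ∑ a, K a * (A * Bᴴ) * (K a)ᴴ := by
  have h : ∀ a, K a * (A * Bᴴ) * (K a)ᴴ = (K a * A) * (K a * B)ᴴ := fun a => by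
    rw [conjTranspose_mul]; simp only [Matrix.mul_assoc]
  ext p q
  simp_rw [h]
  rw [Matrix.sum_apply, mul_apply, Fintype.sum_prod_type, Finset.sum_comm]
  simp only [kraus, conjTranspose_apply, of_apply]
  rfl

variable [Fintype m]

lemma hsRe_kraus [DecidableEq n] {K : r → Matrix m n ℂ} (hK : ∑ a, (K a)ᴴ * K a = 1)
    (A B : Matrix n e ℂ) : hsRe (kraus K A) (kraus K B) = hsRe A B := by
  have h1 : ((kraus K A)ᴴ * kraus K B).trace = ∑ a, ((K a * A)ᴴ * (K a * B)).trace := by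
    simp only [trace, diag, mul_apply (M := (kraus K A)ᴴ), Fintype.sum_prod_type]
    rw [Finset.sum_comm]
    refine Finset.sum_congr rfl fun a _ => Finset.sum_congr rfl fun i _ => ?_
    rw [mul_apply]
    rfl
  rw [hsRe, hsRe, h1, ← trace_sum]
  have h2 : ∑ a, (K a * A)ᴴ * (K a * B) = Aᴴ * (∑ a, (K a)ᴴ * K a) * B := by
    rw [Matrix.mul_sum, Matrix.sum_mul]
    refine Finset.sum_congr rfl fun a _ => ?_
    rw [conjTranspose_mul]; simp only [Matrix.mul_assoc]
  rw [h2, hK, Matrix.mul_one]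

/-- Every channel has Kraus operators: they are read off from a square root of its Choi matrix. -/
lemma IsChannel.exists_kraus [DecidableEq n] [DecidableEq m] {Φ : SuperOp n m}
    (hΦ : IsChannel Φ) :
    ∃ (r : Type) (_ : Fintype r) (K : r → Matrix m n ℂ),
      ∑ a, (K a)ᴴ * K a = 1 ∧ ∀ X, Φ X = ∑ a, K a * X * (K a)ᴴ := by
  let f := Fintype.equivFin n
  -- the unnormalised maximally entangled vector, whose image under the channel is the Choi matrix
  let u : n × Fin (Fintype.card n) → ℂ := fun p => if f p.1 = p.2 then 1 else 0
  have hC := hΦ.completelyPositive _ _ (posSemidef_vecMulVec_self_star u)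
  obtain ⟨B, hB⟩ := exists_eq_mul_conjTranspose_self hC
  let K : m × Fin (Fintype.card n) → Matrix m n ℂ := fun a => Matrix.of fun p i => B (p, f i) a
  have hsingle : ∀ i j, Φ (single i j (1 : ℂ)) = ∑ a, K a * single i j (1 : ℂ) * (K a)ᴴ := by
    intro i j
    ext p q
    have h1 : Φ (single i j 1) p q = ampliate _ Φ (vecMulVec u (star u)) (p, f i) (q, f j) := by
      simp only [ampliate, LinearMap.coe_mk, AddHom.coe_mk, of_apply]
      have hm : (Matrix.of fun a b => vecMulVec u (star u) (a, f i) (b, f j)) =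
          single i j (1 : ℂ) := by
        ext a b
        simp only [of_apply, vecMulVec_apply, Pi.star_apply, u, f.injective.eq_iff, single_apply]
        by_cases ha : a = i <;> by_cases hb : b = j <;>
          simp [ha, hb, eq_comm (a := i), eq_comm (a := j)]
      rw [hm]
    rw [h1, hB, mul_apply, Matrix.sum_apply]
    refine Finset.sum_congr rfl fun a _ => ?_
    simp [K, mul_apply, single_apply, Finset.sum_ite_eq, conjTranspose_apply, ite_and]
  have hall : ∀ X, Φ X = ∑ a, K a * X * (K a)ᴴ := by
    intro X
    conv_lhs => rw [matrix_eq_sum_single X]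
    conv_rhs => rw [matrix_eq_sum_single X]
    simp only [map_sum, Matrix.mul_sum, Matrix.sum_mul]
    rw [Finset.sum_comm' (t' := Finset.univ) (s' := fun _ => Finset.univ) (by simp)]
    conv_rhs => rw [Finset.sum_comm]
    rw [Finset.sum_comm]
    refine Finset.sum_congr rfl fun i _ => ?_
    conv_rhs => rw [Finset.sum_comm]
    refine Finset.sum_congr rfl fun j _ => ?_
    have : single i j (X i j) = X i j • single i j (1 : ℂ) := by simp
    simp only [this, map_smul, hsingle, Matrix.mul_smul, Matrix.smul_mul, Finset.smul_sum]
  refine ⟨_, inferInstance, K, ?_, hall⟩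
  ext i j
  have h := hΦ.tracePreserving (single j i (1 : ℂ))
  rw [hall, trace_sum] at h
  have h2 : ∀ a, (K a * single j i (1 : ℂ) * (K a)ᴴ).trace = ((K a)ᴴ * K a) i j := by
    intro a
    rw [Matrix.trace_mul_comm, ← Matrix.mul_assoc, Matrix.trace_mul_single]
    simp
  rw [Matrix.sum_apply, ← Finset.sum_congr rfl fun a _ => h2 a, h]
  by_cases hij : i = j
  · subst hij; rw [trace_single_eq_same, one_apply_eq]
  · rw [one_apply_ne hij, trace_single_eq_of_ne _ _ _ (Ne.symm hij)]

end Kraus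

/-! ### Von Neumann measurements -/

lemma ampliate_sub {n m k : Type} (Φ Ψ : SuperOp n m) (X : Matrix (n × k) (n × k) ℂ) :
    ampliate k (Φ - Ψ) X = ampliate k Φ X - ampliate k Ψ X := by
  ext p q; simp [ampliate]

section VonNeumann

variable {n k : Type} [Fintype n] [Fintype k] [DecidableEq n] [DecidableEq k]

/-- The projections `|i⟩⟨i| ⊗ 1`. -/
def blockProj (k : Type) [DecidableEq k] (i : n) : Matrix (n × k) (n × k) ℂ :=
  diagonal fun p => if p.1 = i then 1 else 0

lemma sum_blockProj :
    ∑ i : n, (blockProj k i)ᴴ * blockProj k i = 1 := by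
  ext p q
  simp only [blockProj, diagonal_conjTranspose, diagonal_mul_diagonal, Matrix.sum_apply]
  by_cases h : p = q
  · subst h; simp
  · simp [diagonal_apply_ne _ h, one_apply_ne h]

open scoped Kronecker in
/-- Measuring in the basis of the columns of `V` is rotating by `Vᴴ` and then dephasing. -/
lemma ampliate_vonNeumann (V : Matrix n n ℂ) (X : Matrix (n × k) (n × k) ℂ) :
    ampliate k (vonNeumann V) X = ∑ i, blockProj k i *
      ((V ⊗ₖ (1 : Matrix k k ℂ))ᴴ * X * (V ⊗ₖ (1 : Matrix k k ℂ))) * (blockProj k i)ᴴ := by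
  ext ⟨i, a⟩ ⟨j, b⟩
  simp only [ampliate, vonNeumann, measureMap, LinearMap.coe_mk, AddHom.coe_mk, of_apply,
    Matrix.sum_apply, blockProj, diagonal_conjTranspose, mul_diagonal, diagonal_mul]
  by_cases hij : i = j
  · subst hij
    simp only [diagonal_apply_eq, vonNeumannEffects]
    simp [mul_apply, trace, diag, vecMulVec_apply, Fintype.sum_prod_type, kroneckerMap_apply,
      one_apply, Finset.sum_mul, Finset.mul_sum]
    refine Finset.sum_congr rfl fun x _ => Finset.sum_congr rfl fun y _ => ?_
    rw [Finset.sum_eq_single a (fun z _ hz => by simp [hz]) (by simp)]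
    simp only [if_true]
    ring
  · rw [diagonal_apply_ne _ hij]
    symm
    refine Finset.sum_eq_zero fun x _ => ?_
    by_cases hx : i = x
    · subst hx; simp [Ne.symm hij]
    · simp [hx]

open scoped Kronecker in
lemma kronecker_one_mem_unitary {V : Matrix n n ℂ} (hV : Vᴴ * V = 1) :
    (V ⊗ₖ (1 : Matrix k k ℂ))ᴴ * (V ⊗ₖ (1 : Matrix k k ℂ)) = 1 := by
  rw [conjTranspose_kronecker, ← mul_kronecker_mul, hV, conjTranspose_one, Matrix.one_mul,
    one_kronecker_one]

/-- The phases of the columns do not matter for the measurement. -/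
lemma vonNeumann_mul_diagonal (U : Matrix n n ℂ) {w : n → ℂ} (hw : ∀ i, ‖w i‖ = 1) :
    vonNeumann (U * diagonal w) = vonNeumann U := by
  have : vonNeumannEffects (U * diagonal w) = vonNeumannEffects U := by
    ext i a b
    simp only [vonNeumannEffects, vecMulVec_apply, mul_diagonal, Pi.star_apply, star_mul']
    have h := Complex.mul_conj' (w i)
    rw [hw] at h
    calc _ = U a i * star (U b i) * (w i * (starRingEnd ℂ) (w i)) := by
          simp only [RCLike.star_def]; ring
      _ = _ := by rw [h]; simp
  rw [vonNeumann, vonNeumann, this]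

lemma conjTranspose_mul_self_mul_diagonal {W : Matrix n n ℂ} (hW : Wᴴ * W = 1) {e : n → ℂ}
    (he : ∀ i, ‖e i‖ = 1) : (W * diagonal e)ᴴ * (W * diagonal e) = 1 := by
  rw [conjTranspose_mul, Matrix.mul_assoc, ← Matrix.mul_assoc Wᴴ, hW, Matrix.one_mul,
    diagonal_conjTranspose, diagonal_mul_diagonal, ← diagonal_one]
  congr 1; ext i
  rw [Pi.star_apply, RCLike.star_def, Complex.conj_mul', he]; simp

end VonNeumann

/-! ### The angle between purifications -/

section Overlap

variable {n m k e : Type} [Fintype n] [Fintype m] [Fintype k] [Fintype e]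

/-- `σ` and `τ` have purifications at an angle of at most `α`, that is, `cos α` is at most the
fidelity of `σ` and `τ` (for `0 ≤ α ≤ π`). The columns of `A` and `B` are the components of the
purifying vectors. -/
def AngleLE (α : ℝ) (σ τ : Matrix n n ℂ) : Prop :=
  ∃ (e : Type) (_ : Fintype e) (A B : Matrix n e ℂ), hsRe A A = 1 ∧ hsRe B B = 1 ∧
    σ = A * Aᴴ ∧ τ = B * Bᴴ ∧ Real.arccos (hsRe A B) ≤ α

lemma AngleLE.isState {α : ℝ} {σ τ : Matrix n n ℂ} (h : AngleLE α σ τ) :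
    IsState σ ∧ IsState τ := by
  obtain ⟨e, _, A, B, hA, hB, rfl, rfl, hAB⟩ := h
  have aux : ∀ {A : Matrix n e ℂ}, hsRe A A = 1 → IsState (A * Aᴴ) := fun {A} hA => by
    have hp := posSemidef_self_mul_conjTranspose A
    refine ⟨hp, ?_⟩
    rw [hsRe, Matrix.trace_mul_comm] at hA
    exact Complex.ext hA (Complex.le_def.1 hp.trace_nonneg).2.symm
  exact ⟨aux hA, aux hB⟩

variable [DecidableEq n]

/-- Channels do not increase the angle. -/
lemma AngleLE.kraus {α : ℝ} {σ τ : Matrix n n ℂ} (h : AngleLE α σ τ) {r : Type} [Fintype r]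
    {K : r → Matrix m n ℂ} (hK : ∑ a, (K a)ᴴ * K a = 1) :
    AngleLE α (∑ a, K a * σ * (K a)ᴴ) (∑ a, K a * τ * (K a)ᴴ) := by
  obtain ⟨e, _, A, B, hA, hB, rfl, rfl, hAB⟩ := h
  exact ⟨e × r, inferInstance, QDisc.kraus K A, QDisc.kraus K B, by rw [hsRe_kraus hK, hA],
    by rw [hsRe_kraus hK, hB], (kraus_mul_conjTranspose K A A).symm,
    (kraus_mul_conjTranspose K B B).symm, by rwa [hsRe_kraus hK]⟩

lemma hsRe_mul_unitary {V : Matrix n n ℂ} (hV : Vᴴ * V = 1) (A B : Matrix n e ℂ) :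
    hsRe (V * A) (V * B) = hsRe A B := by
  rw [hsRe, hsRe, conjTranspose_mul, Matrix.mul_assoc, ← Matrix.mul_assoc Vᴴ, hV, Matrix.one_mul]

variable [DecidableEq k]

/-- A lower bound `c` on the real part of the numerical range of `V` bounds the overlap of any
vector with its rotated copy, also in the presence of an ancilla. -/
lemma mul_hsRe_le_hsRe_mul {V : Matrix n n ℂ} {c : ℝ}
    (hc : (V + Vᴴ - ((2 * c : ℝ) : ℂ) • (1 : Matrix n n ℂ)).PosSemidef) (A : Matrix n e ℂ) :
    c * hsRe A A ≤ hsRe (Vᴴ * A) A := by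
  have h := (Complex.le_def.1 (hc.conjTranspose_mul_mul_same A).trace_nonneg).1
  have e1 : hsRe A (Vᴴ * A) = hsRe (Vᴴ * A) A := hsRe_comm _ _
  simp only [hsRe, conjTranspose_mul, conjTranspose_conjTranspose] at e1 ⊢
  rw [Matrix.mul_sub, Matrix.mul_add, Matrix.sub_mul, Matrix.add_mul, trace_sub, trace_add,
    Matrix.mul_smul, Matrix.smul_mul, trace_smul, Matrix.mul_one, Complex.sub_re, Complex.add_re,
    smul_eq_mul, Complex.re_ofReal_mul, Matrix.mul_assoc Aᴴ Vᴴ, e1] at h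
  simp only [Complex.zero_re] at h
  linarith

open scoped Kronecker in
lemma posSemidef_kronecker_one {V : Matrix n n ℂ} {c : ℝ}
    (hc : (V + Vᴴ - ((2 * c : ℝ) : ℂ) • (1 : Matrix n n ℂ)).PosSemidef) :
    ((V ⊗ₖ (1 : Matrix k k ℂ)) + (V ⊗ₖ (1 : Matrix k k ℂ))ᴴ -
      ((2 * c : ℝ) : ℂ) • (1 : Matrix (n × k) (n × k) ℂ)).PosSemidef := by
  have h := hc.kronecker (PosSemidef.one (n := k) (R := ℂ))
  rw [sub_eq_add_neg, ← neg_smul, add_kronecker, add_kronecker, smul_kronecker,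
    one_kronecker_one] at h
  rwa [conjTranspose_kronecker, conjTranspose_one, sub_eq_add_neg, ← neg_smul]

/-- The use of the box `P_V` on the one side and of `P_1` on the other increases the angle at most
by that between a vector and its image under `V`. -/
lemma AngleLE.ampliate_vonNeumann {α c : ℝ} {σ τ : Matrix (n × k) (n × k) ℂ}
    (h : AngleLE α σ τ) {V : Matrix n n ℂ} (hV : V * Vᴴ = 1)
    (hc : (V + Vᴴ - ((2 * c : ℝ) : ℂ) • (1 : Matrix n n ℂ)).PosSemidef) :
    AngleLE (Real.arccos c + α) (ampliate k (vonNeumann V) σ) (ampliate k (vonNeumann 1) τ) := by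
  rw [QDisc.ampliate_vonNeumann, QDisc.ampliate_vonNeumann]
  refine AngleLE.kraus ?_ sum_blockProj
  obtain ⟨e, _, A, B, hA, hB, rfl, rfl, hAB⟩ := h
  have hc' := posSemidef_kronecker_one (k := k) hc
  have hU := kronecker_one_mem_unitary (k := k) (V := Vᴴ) (by simpa using hV)
  have hVk : (kroneckerMap (· * ·) V (1 : Matrix k k ℂ))ᴴ =
      kroneckerMap (· * ·) Vᴴ (1 : Matrix k k ℂ) := by
    rw [conjTranspose_kronecker, conjTranspose_one]
  set W := kroneckerMap (· * ·) V (1 : Matrix k k ℂ)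
  rw [← hVk] at hU
  have hA' : hsRe (Wᴴ * A) (Wᴴ * A) = 1 := by rw [hsRe_mul_unitary hU, hA]
  refine ⟨e, inferInstance, Wᴴ * A, B, hA', hB, ?_, ?_, ?_⟩
  · rw [conjTranspose_mul, conjTranspose_conjTranspose]; simp only [Matrix.mul_assoc]
  · simp
  · refine (arccos_hsRe_triangle hA' hA hB).trans (add_le_add ?_ hAB)
    refine Real.arccos_le_arccos ?_
    have := mul_hsRe_le_hsRe_mul hc' A
    rwa [hA, mul_one] at this

lemma angleLE_refl {ρ : Matrix n n ℂ} (hρ : IsState ρ) : AngleLE 0 ρ ρ := by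
  obtain ⟨A, rfl⟩ := exists_eq_mul_conjTranspose_self hρ.1
  have hA : hsRe A A = 1 := by rw [hsRe, Matrix.trace_mul_comm, hρ.2, Complex.one_re]
  exact ⟨n, inferInstance, A, A, hA, hA, rfl, rfl, by rw [hA, Real.arccos_one]⟩

/-- The outputs of a network, when a vector and its image under `V` overlap by at least `c`. -/
lemma angleLE_stateAfter {d N : ℕ} (W : Network d N) {V : Matrix (Fin d) (Fin d) ℂ} {c : ℝ}
    (hV : V * Vᴴ = 1)
    (hc : (V + Vᴴ - ((2 * c : ℝ) : ℂ) • (1 : Matrix (Fin d) (Fin d) ℂ)).PosSemidef) :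
    ∀ k ≤ N, AngleLE (k * Real.arccos c) (W.stateAfter (vonNeumann V) k)
      (W.stateAfter (vonNeumann 1) k)
  | 0, _ => by
    rw [Nat.cast_zero, zero_mul]
    exact angleLE_refl W.isState_init
  | k + 1, hk => by
    obtain ⟨r, _, K, hK, hΦ⟩ := (W.isChannel_process k hk).exists_kraus
    have h := ((angleLE_stateAfter W hV hc k (by omega)).ampliate_vonNeumann hV hc).kraus hK
    rw [← hΦ, ← hΦ] at h
    have e : Real.arccos c + k * Real.arccos c = ((k + 1 : ℕ) : ℝ) * Real.arccos c := by
      push_cast; ring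
    rwa [e] at h
  termination_by k => k

lemma AngleLE.traceNorm_sub_le {α : ℝ} {σ τ : Matrix n n ℂ} (h : AngleLE α σ τ)
    (hα : α ≤ Real.pi / 2) : traceNorm (σ - τ) ≤ 2 * √(1 - Real.cos α ^ 2) := by
  obtain ⟨e, _, A, B, hA, hB, rfl, rfl, hAB⟩ := h
  refine (QDisc.traceNorm_sub_le hB hA hB hA).trans ?_
  have hle : hsRe A B ≤ 1 := by simpa [hA, hB] using hsRe_le_sqrt_mul_sqrt A B
  have h0 : 0 ≤ Real.arccos (hsRe A B) := Real.arccos_nonneg _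
  have hcos : Real.cos α ≤ hsRe A B := by
    have h1 := Real.cos_le_cos_of_nonneg_of_le_pi h0 (by linarith [Real.pi_pos]) hAB
    have h2 : 0 ≤ hsRe A B := Real.arccos_le_pi_div_two.1 (hAB.trans hα)
    rwa [Real.cos_arccos (by linarith) hle] at h1
  have hcos0 : 0 ≤ Real.cos α := Real.cos_nonneg_of_neg_pi_div_two_le_of_le
    (by linarith [Real.pi_pos]) hα
  have : 2 * √(1 - Real.cos α ^ 2) = √(4 - (2 * Real.cos α) ^ 2) := by
    rw [show 4 - (2 * Real.cos α) ^ 2 = 2 ^ 2 * (1 - Real.cos α ^ 2) by ring,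
      Real.sqrt_mul (by norm_num), Real.sqrt_sq (by norm_num)]
  rw [this]
  refine Real.sqrt_le_sqrt ?_
  nlinarith

lemma AngleLE.traceNorm_sub_le_two {α : ℝ} {σ τ : Matrix n n ℂ} (h : AngleLE α σ τ) :
    traceNorm (σ - τ) ≤ 2 := by
  obtain ⟨e, _, A, B, hA, hB, rfl, rfl, hAB⟩ := h
  refine (QDisc.traceNorm_sub_le hB hA hB hA).trans ?_
  rw [Real.sqrt_le_left (by norm_num)]
  nlinarith [sq_nonneg (hsRe A B + hsRe A B)]

/-- The trivial bound `-1` for the overlap of a vector and its image under a unitary matrix. -/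
lemma posSemidef_add_conjTranspose_of_unitary {V : Matrix n n ℂ} (hV : V * Vᴴ = 1) :
    (V + Vᴴ - ((2 * (-1) : ℝ) : ℂ) • (1 : Matrix n n ℂ)).PosSemidef := by
  have : V + Vᴴ - ((2 * (-1) : ℝ) : ℂ) • (1 : Matrix n n ℂ) = (1 + V) * (1 + V)ᴴ := by
    rw [conjTranspose_add, conjTranspose_one, Matrix.mul_add, Matrix.add_mul, Matrix.add_mul, hV]
    push_cast
    simp only [Matrix.one_mul, Matrix.mul_one]
    module
  rw [this]
  exact posSemidef_self_mul_conjTranspose _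

/-- The bound for one use of the box and an arbitrary, possibly non-Hermitian, input. -/
lemma traceNorm_ampliate_le {V : Matrix n n ℂ} {c : ℝ} (hV : V * Vᴴ = 1)
    (hc : (V + Vᴴ - ((2 * c : ℝ) : ℂ) • (1 : Matrix n n ℂ)).PosSemidef)
    {X : Matrix (n × k) (n × k) ℂ} (hX : traceNorm X = 1) :
    ∃ s, c ≤ s ∧ traceNorm (ampliate k (vonNeumann V - vonNeumann 1) X) ≤
      √(4 - (2 * s) ^ 2) := by
  obtain ⟨A, B, hAB, hA, hB⟩ := exists_eq_mul_conjTranspose X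
  rw [hX] at hA hB
  have hc' := posSemidef_kronecker_one (k := k) hc
  have hU := kronecker_one_mem_unitary (k := k) (V := Vᴴ) (by simpa using hV)
  have hVk : (kroneckerMap (· * ·) V (1 : Matrix k k ℂ))ᴴ =
      kroneckerMap (· * ·) Vᴴ (1 : Matrix k k ℂ) := by
    rw [conjTranspose_kronecker, conjTranspose_one]
  rw [ampliate_sub, ampliate_vonNeumann, ampliate_vonNeumann]
  set W := kroneckerMap (· * ·) V (1 : Matrix k k ℂ)
  rw [← hVk] at hU
  have h1 : Wᴴ * X * W = (Wᴴ * A) * (Wᴴ * B)ᴴ := by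
    rw [conjTranspose_mul, conjTranspose_conjTranspose, hAB]; simp only [Matrix.mul_assoc]
  have h2 : (kroneckerMap (· * ·) (1 : Matrix n n ℂ) (1 : Matrix k k ℂ))ᴴ * X *
      kroneckerMap (· * ·) (1 : Matrix n n ℂ) (1 : Matrix k k ℂ) = A * Bᴴ := by
    rw [one_kronecker_one, conjTranspose_one, Matrix.one_mul, Matrix.mul_one, hAB]
  simp only [h1, h2, ← kraus_mul_conjTranspose]
  have hK := sum_blockProj (n := n) (k := k)
  refine ⟨(hsRe (Wᴴ * A) A + hsRe (Wᴴ * B) B) / 2, ?_, (traceNorm_sub_le ?_ ?_ ?_ ?_).trans ?_⟩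
  · have a1 := mul_hsRe_le_hsRe_mul hc' A
    have b1 := mul_hsRe_le_hsRe_mul hc' B
    rw [hA] at a1; rw [hB] at b1
    linarith
  · rw [hsRe_kraus hK, hA]
  · rw [hsRe_kraus hK, hsRe_mul_unitary hU, hA]
  · rw [hsRe_kraus hK, hB]
  · rw [hsRe_kraus hK, hsRe_mul_unitary hU, hB]
  · rw [hsRe_kraus hK, hsRe_kraus hK, mul_div_cancel₀ _ (by norm_num : (2 : ℝ) ≠ 0)]

end Overlap

/-! ### The least fidelity and the choice of phases -/

section SingleShot

variable {n : Type} [Fintype n]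

/-- The root fidelity of the outputs of `P_W` and `P_1`, applied to one half of a purification
of `ρ`. -/
noncomputable def boxFidelity (W ρ : Matrix n n ℂ) : ℝ := ∑ i, ‖(ρ * W) i i‖

lemma boxFidelity_nonneg (W ρ : Matrix n n ℂ) : 0 ≤ boxFidelity W ρ :=
  Finset.sum_nonneg fun _ _ => norm_nonneg _

lemma convex_isState : Convex ℝ {ρ : Matrix n n ℂ | IsState ρ} := by
  rintro ρ ⟨hρ, hρ1⟩ τ ⟨hτ, hτ1⟩ a b ha hb hab
  have e : ∀ (x : ℝ) (M : Matrix n n ℂ), x • M = (x : ℂ) • M := fun x M => by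
    ext; simp
  refine ⟨?_, ?_⟩
  · rw [e, e]
    exact (hρ.smul (by exact_mod_cast ha)).add (hτ.smul (by exact_mod_cast hb))
  · rw [trace_add, trace_smul, trace_smul, hρ1, hτ1]
    simp only [Complex.real_smul, mul_one]
    exact_mod_cast hab

variable [DecidableEq n]

/-- The least fidelity is attained: states are the matrices `A * Aᴴ` with `A` in a Euclidean
sphere, which is compact. -/
lemma exists_isState_boxFidelity_le [Nonempty n] (W : Matrix n n ℂ) :
    ∃ ρ, IsState ρ ∧ ∀ τ, IsState τ → boxFidelity W ρ ≤ boxFidelity W τ := by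
  have htr : ∀ A : Matrix n n ℂ, (A * Aᴴ).trace = ((∑ i, ∑ j, ‖A i j‖ ^ 2 : ℝ) : ℂ) := fun A => by
    simp only [trace, diag, mul_apply, conjTranspose_apply]
    push_cast
    exact Finset.sum_congr rfl fun i _ => Finset.sum_congr rfl fun j _ => Complex.mul_conj' _
  let S : Set (n → n → ℂ) := {A | ∑ i, ∑ j, ‖A i j‖ ^ 2 = 1}
  have hcl : IsClosed S := isClosed_eq (by fun_prop) continuous_const
  have hbd : Bornology.IsBounded S := by
    refine (Metric.isBounded_closedBall (x := (0 : n → n → ℂ)) (r := 1)).subset fun A hA => ?_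
    rw [mem_closedBall_zero_iff, pi_norm_le_iff_of_nonneg zero_le_one]
    intro i
    rw [pi_norm_le_iff_of_nonneg zero_le_one]
    intro j
    have h1 : ‖A i j‖ ^ 2 ≤ ∑ j, ‖A i j‖ ^ 2 :=
      Finset.single_le_sum (f := fun j => ‖A i j‖ ^ 2) (fun _ _ => by positivity)
        (Finset.mem_univ j)
    have h2 : ∑ j, ‖A i j‖ ^ 2 ≤ ∑ i, ∑ j, ‖A i j‖ ^ 2 :=
      Finset.single_le_sum (f := fun i => ∑ j, ‖A i j‖ ^ 2) (fun _ _ => by positivity)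
        (Finset.mem_univ i)
    have h3 : ∑ i, ∑ j, ‖A i j‖ ^ 2 = 1 := hA
    exact (sq_le_one_iff₀ (norm_nonneg _)).1 (by linarith)
  have hne : S.Nonempty := by
    obtain ⟨i₀⟩ := ‹Nonempty n›
    refine ⟨fun i j => if i = i₀ ∧ j = i₀ then 1 else 0, ?_⟩
    show ∑ i, ∑ j, _ = (1 : ℝ)
    rw [Finset.sum_eq_single i₀, Finset.sum_eq_single i₀] <;> simp +contextual
  have hcont : Continuous fun A : n → n → ℂ =>
      boxFidelity W ((Matrix.of A) * (Matrix.of A)ᴴ) := by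
    simp only [boxFidelity, mul_apply, conjTranspose_apply, of_apply]
    fun_prop
  obtain ⟨A, hA, hmin⟩ := (Metric.isCompact_of_isClosed_isBounded hcl hbd).exists_isMinOn hne
    hcont.continuousOn
  refine ⟨Matrix.of A * (Matrix.of A)ᴴ, ⟨posSemidef_self_mul_conjTranspose _, ?_⟩, ?_⟩
  · rw [htr]
    simp only [of_apply]
    rw [show ∑ i, ∑ j, ‖A i j‖ ^ 2 = 1 from hA, Complex.ofReal_one]
  · intro τ hτ
    obtain ⟨B, rfl⟩ := exists_eq_mul_conjTranspose_self hτ.1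
    refine hmin (a := fun i j => B i j) ?_
    have h := hτ.2
    rw [htr] at h
    exact_mod_cast h

lemma trace_mul_nonneg {A B : Matrix n n ℂ} (hA : A.PosSemidef) (hB : B.PosSemidef) :
    0 ≤ (A * B).trace.re := by
  obtain ⟨C, rfl⟩ := exists_eq_mul_conjTranspose_self hA
  rw [Matrix.mul_assoc, Matrix.trace_mul_comm]
  exact (Complex.le_def.1 (hB.conjTranspose_mul_mul_same C).trace_nonneg).1

lemma mul_eq_zero_of_trace_mul_eq_zero {A B : Matrix n n ℂ} (hA : A.PosSemidef)
    (hB : B.PosSemidef) (h : (A * B).trace.re = 0) : A * B = 0 := by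
  obtain ⟨C, rfl⟩ := exists_eq_mul_conjTranspose_self hA
  obtain ⟨D, rfl⟩ := exists_eq_mul_conjTranspose_self hB
  have h1 : (C * Cᴴ * (D * Dᴴ)).trace = ((Dᴴ * C)ᴴ * (Dᴴ * C)).trace := by
    rw [conjTranspose_mul, conjTranspose_conjTranspose, Matrix.mul_assoc, Matrix.trace_mul_comm]
    simp only [Matrix.mul_assoc]
  have h2 := (Complex.le_def.1 (posSemidef_conjTranspose_mul_self (Dᴴ * C)).trace_nonneg).2
  have h3 : ((Dᴴ * C)ᴴ * (Dᴴ * C)).trace = 0 := by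
    rw [h1] at h
    exact Complex.ext h h2.symm
  have h4 := (trace_conjTranspose_mul_self_eq_zero_iff).1 h3
  have h5 : Cᴴ * D = 0 := by simpa using congrArg conjTranspose h4
  rw [Matrix.mul_assoc, ← Matrix.mul_assoc Cᴴ, h5]
  simp

/-- The separation of the convex set of the diagonals of `ρ * W` from an `ℓ¹`-ball. -/
lemma exists_weights {W : Matrix n n ℂ} {c : ℝ} (hc : 0 < c)
    (hW : ∀ ρ : Matrix n n ℂ, IsState ρ → c ≤ boxFidelity W ρ) :
    ∃ w : n → ℂ, (∀ i, ‖w i‖ ≤ 1) ∧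
      ∀ ρ : Matrix n n ℂ, IsState ρ → c ≤ (∑ i, w i * (ρ * W) i i).re := by
  let B : Set (n → ℂ) := {z | ∑ i, ‖z i‖ < c}
  let K : Set (n → ℂ) := (fun ρ : Matrix n n ℂ => fun i => (ρ * W) i i) '' {ρ | IsState ρ}
  have hBo : IsOpen B := isOpen_lt (by fun_prop) continuous_const
  have hBc : Convex ℝ B := by
    intro x hx y hy a b ha hb hab
    have hx' : ∑ i, ‖x i‖ < c := hx
    have hy' : ∑ i, ‖y i‖ < c := hy
    have h1 : ∑ i, ‖(a • x + b • y) i‖ ≤ a * ∑ i, ‖x i‖ + b * ∑ i, ‖y i‖ := by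
      rw [Finset.mul_sum, Finset.mul_sum, ← Finset.sum_add_distrib]
      refine Finset.sum_le_sum fun i _ => (norm_add_le _ _).trans (le_of_eq ?_)
      simp [abs_of_nonneg ha, abs_of_nonneg hb]
    show ∑ i, ‖(a • x + b • y) i‖ < c
    refine h1.trans_lt ?_
    rcases ha.eq_or_lt with rfl | ha'
    · have : b = 1 := by linarith
      subst this; linarith
    · have := mul_lt_mul_of_pos_left hx' ha'
      have := mul_le_mul_of_nonneg_left hy'.le hb
      calc _ < a * c + b * c := by linarith
        _ = c := by rw [← add_mul, hab, one_mul]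
  have hKc : Convex ℝ K := by
    rintro _ ⟨ρ, hρ, rfl⟩ _ ⟨τ, hτ, rfl⟩ a b ha hb hab
    refine ⟨a • ρ + b • τ, convex_isState hρ hτ ha hb hab, ?_⟩
    ext i
    simp [Matrix.add_mul]
  have hdisj : Disjoint B K := by
    rw [Set.disjoint_left]
    rintro _ hz ⟨ρ, hρ, rfl⟩
    exact absurd (hW ρ hρ) (not_le.2 hz)
  obtain ⟨f, u, hfB, hfK⟩ := RCLike.geometric_hahn_banach_open (𝕜 := ℂ) hBc hBo hKc hdisj
  have hu : 0 < u := by simpa using hfB 0 (by simpa [B] using hc)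
  have hf : ∀ z, f z = ∑ i, f (Pi.single i 1) * z i := by
    intro z
    conv_lhs => rw [← Finset.univ_sum_single z, map_sum]
    refine Finset.sum_congr rfl fun i _ => ?_
    have : (Pi.single i (z i) : n → ℂ) = z i • Pi.single i 1 := by
      rw [← Pi.single_smul, smul_eq_mul, mul_one]
    rw [this, map_smul, smul_eq_mul, mul_comm]
  have hnorm : ∀ i, ‖f (Pi.single i 1)‖ * c ≤ u := by
    intro i
    by_contra! hlt
    have hpos : 0 < ‖f (Pi.single i 1)‖ := by
      rcases (norm_nonneg (f (Pi.single i 1))).eq_or_lt with h | h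
      · rw [← h] at hlt; linarith
      · exact h
    set a := f (Pi.single i 1)
    -- the point of the ball where the functional would be at least `u`
    let z : n → ℂ := Pi.single i (((u / ‖a‖ ^ 2 : ℝ) : ℂ) * (starRingEnd ℂ) a)
    have hz : z ∈ B := by
      show ∑ j, ‖z j‖ < c
      rw [Finset.sum_eq_single i (fun j _ hj => by simp [z, Pi.single_eq_of_ne hj]) (by simp)]
      simp only [z, Pi.single_eq_same, norm_mul, Complex.norm_real, Complex.norm_conj,
        Real.norm_eq_abs]
      rw [abs_of_pos (by positivity)]
      have : u / ‖a‖ ^ 2 * ‖a‖ = u / ‖a‖ := by field_simp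
      rw [this, div_lt_iff₀ hpos, mul_comm]
      exact hlt
    have h1 := hfB z hz
    rw [hf, Finset.sum_eq_single i (fun j _ hj => by simp [z, Pi.single_eq_of_ne hj]) (by simp)]
      at h1
    have h2 : f (Pi.single i 1) * z i = (u : ℂ) := by
      simp only [z, Pi.single_eq_same]
      change a * _ = _
      rw [mul_left_comm, Complex.mul_conj', ← Complex.ofReal_pow, ← Complex.ofReal_mul]
      congr 1
      field_simp
    rw [h2] at h1
    simp at h1
  refine ⟨fun i => ((c / u : ℝ) : ℂ) * f (Pi.single i 1), fun i => ?_, fun ρ hρ => ?_⟩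
  · rw [norm_mul, Complex.norm_real, Real.norm_eq_abs, abs_of_pos (by positivity),
      div_mul_eq_mul_div, div_le_one hu, mul_comm]
    exact hnorm i
  · have h1 := hfK _ ⟨ρ, hρ, rfl⟩
    rw [hf] at h1
    simp only [mul_assoc]
    rw [← Finset.mul_sum, Complex.re_ofReal_mul]
    have h2 : c = c / u * u := by field_simp
    calc c = c / u * u := h2
      _ ≤ _ := mul_le_mul_of_nonneg_left h1 (by positivity)

/-- A lower bound on the fidelity for all inputs yields phases of the columns of `W` such that the
real parts of the numerical range of the rotated matrix `V` satisfy the same bound. The separating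
functional has weights of modulus at most one, and the phases are those of the weights. That the
moduli do not matter is seen on the projections onto the eigenspaces of `V + Vᴴ`, which commute
with `V`. -/
lemma exists_phases {W : Matrix n n ℂ} (hU : Wᴴ * W = 1) {c : ℝ} (hc : 0 < c)
    (hW : ∀ ρ : Matrix n n ℂ, IsState ρ → c ≤ boxFidelity W ρ) :
    ∃ e : n → ℂ, (∀ i, ‖e i‖ = 1) ∧
      (W * diagonal e + (W * diagonal e)ᴴ - ((2 * c : ℝ) : ℂ) • (1 : Matrix n n ℂ)).PosSemidef := by
  obtain ⟨w, hw, hwc⟩ := exists_weights hc hW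
  let e : n → ℂ := fun i => if w i = 0 then 1 else w i / ‖w i‖
  have he : ∀ i, ‖e i‖ = 1 := fun i => by
    simp only [e]; split_ifs with h
    · simp
    · simp [norm_ne_zero_iff.2 h]
  have hew : ∀ i, w i = ‖w i‖ * e i := fun i => by
    simp only [e]; split_ifs with h
    · simp [h]
    · have : (‖w i‖ : ℂ) ≠ 0 := by exact_mod_cast norm_ne_zero_iff.2 h
      field_simp
  refine ⟨e, he, ?_⟩
  have hV1 : (W * diagonal e)ᴴ * (W * diagonal e) = 1 := 
    conjTranspose_mul_self_mul_diagonal hU he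
  have hV2 : (W * diagonal e) * (W * diagonal e)ᴴ = 1 := mul_eq_one_comm.1 hV1
  have hVe : ∀ (ρ : Matrix n n ℂ) i, (ρ * (W * diagonal e)) i i = (ρ * W) i i * e i := by
    intro ρ i
    rw [← Matrix.mul_assoc, mul_diagonal]
  set V := W * diagonal e
  clear_value V
  have hM : (V + Vᴴ).IsHermitian := by
    rw [IsHermitian, conjTranspose_add, conjTranspose_conjTranspose, add_comm]
  obtain ⟨Q, hQ1, hQ2, hMQ⟩ := exists_unitary_diagonalization hM
  set l := hM.eigenvalues
  have hcomm : V * (V + Vᴴ) = (V + Vᴴ) * V := by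
    rw [Matrix.mul_add, Matrix.add_mul, hV1, hV2]
  suffices hl : ∀ j, 2 * c ≤ l j by
    have h1 : V + Vᴴ - ((2 * c : ℝ) : ℂ) • (1 : Matrix n n ℂ) =
        Q * diagonal (fun i => ((l i - 2 * c : ℝ) : ℂ)) * Qᴴ := by
      have h2 : diagonal (fun i => ((l i - 2 * c : ℝ) : ℂ)) =
          diagonal (fun i => (l i : ℂ)) - ((2 * c : ℝ) : ℂ) • (1 : Matrix n n ℂ) := by
        rw [← diagonal_one, ← diagonal_smul, diagonal_sub]
        congr 1; ext i; simp
      rw [h2, Matrix.mul_sub, Matrix.sub_mul, ← hMQ, Matrix.mul_smul, Matrix.mul_one,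
        Matrix.smul_mul, hQ2]
    rw [h1]
    refine PosSemidef.mul_mul_conjTranspose_same (PosSemidef.diagonal fun i => ?_) Q
    simp only [Pi.zero_apply]
    exact_mod_cast sub_nonneg.2 (hl i)
  intro j₀
  -- `P` is the projection onto the eigenspace for `l j₀`
  let p : n → ℂ := fun j => if l j = l j₀ then 1 else 0
  let P : Matrix n n ℂ := Q * diagonal p * Qᴴ
  have hPp : P.PosSemidef :=
    PosSemidef.mul_mul_conjTranspose_same (PosSemidef.diagonal fun i => by
      simp only [p, Pi.zero_apply]; split_ifs <;> simp) Q
  have hPM : P * (V + Vᴴ) = (l j₀ : ℂ) • P := by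
    simp only [P]
    rw [hMQ]
    simp only [Matrix.mul_assoc]
    rw [← Matrix.mul_assoc Qᴴ, hQ1, Matrix.one_mul, ← Matrix.mul_assoc (diagonal _),
      diagonal_mul_diagonal, ← Matrix.mul_smul, ← Matrix.smul_mul, ← diagonal_smul]
    congr 3; ext i
    simp only [p, Pi.smul_apply, smul_eq_mul]
    split_ifs with h
    · rw [h]; ring
    · simp
  have hPV : P * V = V * P := by
    have h1 : (Qᴴ * V * Q) * diagonal (fun i => (l i : ℂ)) =
        diagonal (fun i => (l i : ℂ)) * (Qᴴ * V * Q) := by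
      have h2 : Qᴴ * (V * (V + Vᴴ)) * Q = Qᴴ * ((V + Vᴴ) * V) * Q := by rw [hcomm]
      rw [hMQ] at h2
      simp only [Matrix.mul_assoc, hQ1, Matrix.mul_one] at h2
      rw [← Matrix.mul_assoc Qᴴ Q, hQ1, Matrix.one_mul] at h2
      simpa only [Matrix.mul_assoc] using h2
    have h3 : diagonal p * (Qᴴ * V * Q) = (Qᴴ * V * Q) * diagonal p := by
      ext i j
      have h4 := congrFun (congrFun h1 i) j
      rw [mul_diagonal, diagonal_mul] at h4 ⊢
      by_cases hij : l i = l j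
      · simp only [p, hij]; ring
      · have h5 : (Qᴴ * V * Q) i j * ((l j : ℂ) - l i) = 0 := by
          rw [mul_sub, h4]; ring
        have h6 : (l j : ℂ) - l i ≠ 0 := by
          rw [sub_ne_zero]; exact_mod_cast Ne.symm hij
        rw [(mul_eq_zero.1 h5).resolve_right h6]; ring
    have h7 : Q * (diagonal p * (Qᴴ * V * Q)) * Qᴴ = Q * (Qᴴ * V * Q * diagonal p) * Qᴴ := by
      rw [h3]
    simp only [Matrix.mul_assoc, hQ2, Matrix.mul_one] at h7
    rw [← Matrix.mul_assoc Q Qᴴ, hQ2, Matrix.one_mul] at h7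
    simp only [P, Matrix.mul_assoc]
    exact h7
  have hPh : Pᴴ = P := hPp.isHermitian.eq
  have hPV' : P * Vᴴ = Vᴴ * P := by
    have h := congrArg conjTranspose hPV
    rw [conjTranspose_mul P, conjTranspose_mul V, hPh] at h
    exact h.symm
  -- the diagonal of `P * V` has real part `l j₀ / 2` times the diagonal of `P`
  have hre : ∀ i, ((P * V) i i).re = l j₀ / 2 * (P i i).re := by
    intro i
    have h1 : ((P * Vᴴ) i i) = star ((P * V) i i) := by
      rw [hPV', ← conjTranspose_apply, conjTranspose_mul P, hPh]
    have h2 := congrFun (congrFun hPM i) i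
    rw [Matrix.mul_add, Matrix.add_apply, h1, Matrix.smul_apply, smul_eq_mul] at h2
    have h3 := congrArg Complex.re h2
    simp at h3
    linarith
  have hPd : ∀ i, 0 ≤ (P i i).re := fun i => (Complex.le_def.1 hPp.diag_nonneg).1
  have hPtr : P.trace = ((P.trace.re : ℝ) : ℂ) :=
    Complex.ext (by simp) (by simpa using (Complex.le_def.1 hPp.trace_nonneg).2.symm)
  have htr : 0 < P.trace.re := by
    have h1 : P.trace = ∑ i, p i := by
      simp only [P]
      rw [Matrix.trace_mul_comm, ← Matrix.mul_assoc, hQ1, Matrix.one_mul, trace_diagonal]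
    rw [h1, Complex.re_sum]
    refine Finset.sum_pos' (fun i _ => ?_) ⟨j₀, Finset.mem_univ _, ?_⟩
    · simp only [p]; split_ifs <;> simp
    · simp [p]
  set t := P.trace.re with ht
  have hstate : IsState (((t⁻¹ : ℝ) : ℂ) • P) := by
    refine ⟨hPp.smul (by exact_mod_cast (inv_pos.2 htr).le), ?_⟩
    rw [trace_smul, hPtr, smul_eq_mul, ← Complex.ofReal_mul, inv_mul_cancel₀ htr.ne',
      Complex.ofReal_one]
  have h1 := hwc _ hstate
  have h2 : (∑ i, w i * ((((t⁻¹ : ℝ) : ℂ) • P) * W) i i).re =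
      t⁻¹ * (l j₀ / 2 * ∑ i, ‖w i‖ * (P i i).re) := by
    rw [Complex.re_sum, Finset.mul_sum, Finset.mul_sum]
    refine Finset.sum_congr rfl fun i _ => ?_
    have : w i * ((((t⁻¹ : ℝ) : ℂ) • P) * W) i i = ((t⁻¹ * ‖w i‖ : ℝ) : ℂ) * (P * V) i i := by
      rw [hVe, Matrix.smul_mul, Matrix.smul_apply, smul_eq_mul]
      nth_rewrite 1 [hew i]
      push_cast; ring
    rw [this, Complex.re_ofReal_mul, hre]
    ring
  rw [h2] at h1
  set x := ∑ i, ‖w i‖ * (P i i).re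
  have hx0 : 0 ≤ x := Finset.sum_nonneg fun i _ => mul_nonneg (norm_nonneg _) (hPd i)
  have hx1 : x ≤ t := by
    rw [ht, trace, Complex.re_sum]
    exact Finset.sum_le_sum fun i _ => mul_le_of_le_one_left (hPd i) (hw i)
  have h3 : c * t ≤ l j₀ / 2 * x := by
    have := mul_le_mul_of_nonneg_left h1 htr.le
    rw [← mul_assoc, mul_inv_cancel₀ htr.ne', one_mul] at this
    linarith
  have hl0 : 0 ≤ l j₀ := by
    by_contra! hneg
    have : l j₀ / 2 * x ≤ 0 := mul_nonpos_of_nonpos_of_nonneg (by linarith) hx0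
    have := mul_pos hc htr
    linarith
  have h4 : c * t ≤ l j₀ / 2 * t := h3.trans (mul_le_mul_of_nonneg_left hx1 (by linarith))
  have := le_of_mul_le_mul_right h4 htr
  linarith

end SingleShot

/-! ### Extremal eigenstates -/

section Eigenstates

variable {n : Type} [Fintype n] [DecidableEq n]

/-- If the least fidelity `c` is positive, the phases can be chosen so that the rotated matrix `V`
has eigenvalues `exp (± i θ)` with `cos θ = c`, and there are states supported on these two
eigenspaces with the same diagonal. For `θ ≠ 0` they are obtained by restricting a state of least
fidelity to the eigenspaces, with the help of `H = (V - Vᴴ) / (2 i sin θ)`, which is `± 1` there. -/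
lemma exists_eigenstates {W ρ : Matrix n n ℂ} (hU : Wᴴ * W = 1) (hρ : IsState ρ)
    (hmin : ∀ τ : Matrix n n ℂ, IsState τ → boxFidelity W ρ ≤ boxFidelity W τ)
    (hpos : 0 < boxFidelity W ρ) :
    boxFidelity W ρ ≤ 1 ∧ ∃ e : n → ℂ, (∀ i, ‖e i‖ = 1) ∧
      (W * diagonal e + (W * diagonal e)ᴴ -
        ((2 * boxFidelity W ρ : ℝ) : ℂ) • (1 : Matrix n n ℂ)).PosSemidef ∧
      ∃ ρ₁ ρ₂ : Matrix n n ℂ, IsState ρ₁ ∧ IsState ρ₂ ∧ (∀ i, ρ₁ i i = ρ₂ i i) ∧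
        ρ₁ * (W * diagonal e) =
          Complex.exp (Real.arccos (boxFidelity W ρ) * Complex.I) • ρ₁ ∧
        ρ₂ * (W * diagonal e) =
          Complex.exp (-(Real.arccos (boxFidelity W ρ) * Complex.I)) • ρ₂ := by
  obtain ⟨e, he, hV⟩ := exists_phases hU hpos hmin
  have hV1 : (W * diagonal e)ᴴ * (W * diagonal e) = 1 := 
    conjTranspose_mul_self_mul_diagonal hU he
  have hsum : ∑ i, ‖(ρ * (W * diagonal e)) i i‖ = boxFidelity W ρ := by
    refine Finset.sum_congr rfl fun i _ => ?_
    rw [← Matrix.mul_assoc, mul_diagonal, norm_mul, he, mul_one]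
  set c := boxFidelity W ρ with hc
  clear_value c
  have hV2 : (W * diagonal e) * (W * diagonal e)ᴴ = 1 := mul_eq_one_comm.1 hV1
  suffices h : c ≤ 1 ∧ ∃ ρ₁ ρ₂ : Matrix n n ℂ, IsState ρ₁ ∧ IsState ρ₂ ∧
      (∀ i, ρ₁ i i = ρ₂ i i) ∧
      ρ₁ * (W * diagonal e) = Complex.exp (Real.arccos c * Complex.I) • ρ₁ ∧
      ρ₂ * (W * diagonal e) = Complex.exp (-(Real.arccos c * Complex.I)) • ρ₂ from
    ⟨h.1, e, he, hV, h.2⟩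
  set V := W * diagonal e
  clear_value V
  have hρh : ρᴴ = ρ := hρ.1.isHermitian.eq
  have hre : (ρ * Vᴴ).trace.re = (ρ * V).trace.re := by
    have h1 : (ρ * Vᴴ).trace = star (ρ * V).trace := by
      rw [← trace_conjTranspose, conjTranspose_mul, hρh, Matrix.trace_mul_comm]
    rw [h1]; simp
  have htr : (ρ * (V + Vᴴ - ((2 * c : ℝ) : ℂ) • (1 : Matrix n n ℂ))).trace.re =
      2 * (ρ * V).trace.re - 2 * c := by
    rw [Matrix.mul_sub, Matrix.mul_add, trace_sub, trace_add, Matrix.mul_smul, Matrix.mul_one,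
      trace_smul, hρ.2, Complex.sub_re, Complex.add_re, hre, smul_eq_mul, mul_one,
      Complex.ofReal_re]
    ring
  have hge := trace_mul_nonneg hρ.1 hV
  rw [htr] at hge
  -- the triangle inequality for the diagonal entries of `ρ * V` is an equality
  have hterm : ∀ i, ‖(ρ * V) i i‖ = ((ρ * V) i i).re := by
    have h0 : ∑ i, (‖(ρ * V) i i‖ - ((ρ * V) i i).re) ≤ 0 := by
      rw [Finset.sum_sub_distrib, hsum, ← Complex.re_sum]
      change c - (ρ * V).trace.re ≤ 0
      linarith
    have h1 : ∀ i ∈ Finset.univ, 0 ≤ ‖(ρ * V) i i‖ - ((ρ * V) i i).re := fun i _ =>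
      sub_nonneg.2 (Complex.re_le_norm _)
    intro i
    have := (Finset.sum_eq_zero_iff_of_nonneg h1).1
      (le_antisymm h0 (Finset.sum_nonneg h1)) i (Finset.mem_univ i)
    linarith
  have him : ∀ i, ((ρ * V) i i).im = 0 := fun i => by
    have h1 := Complex.sq_norm ((ρ * V) i i)
    rw [hterm, Complex.normSq_apply] at h1
    nlinarith
  have hctr : (ρ * V).trace.re = c := by
    rw [← hsum, trace, Complex.re_sum]
    exact Finset.sum_congr rfl fun i _ => (hterm i).symm
  have hρM : ρ * (V + Vᴴ) = ((2 * c : ℝ) : ℂ) • ρ := by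
    have h := mul_eq_zero_of_trace_mul_eq_zero hρ.1 hV (by rw [htr, hctr]; ring)
    rw [Matrix.mul_sub, Matrix.mul_smul, Matrix.mul_one, sub_eq_zero] at h
    exact h
  have hsq : (1 - V) * (1 - V)ᴴ = (2 : ℂ) • (1 : Matrix n n ℂ) - (V + Vᴴ) := by
    rw [conjTranspose_sub, conjTranspose_one, Matrix.mul_sub, Matrix.sub_mul, Matrix.sub_mul, hV2,
      Matrix.one_mul, Matrix.one_mul, Matrix.mul_one]
    module
  have hc1 : c ≤ 1 := by
    have h := trace_mul_nonneg hρ.1 (posSemidef_self_mul_conjTranspose (1 - V))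
    rw [hsq, Matrix.mul_sub, hρM, Matrix.mul_smul, Matrix.mul_one, trace_sub, trace_smul,
      trace_smul, hρ.2] at h
    simp at h
    linarith
  refine ⟨hc1, ?_⟩
  set s := √(1 - c ^ 2) with hs_def
  have hs2 : s ^ 2 = 1 - c ^ 2 := Real.sq_sqrt (by nlinarith)
  have hexp : Complex.exp (Real.arccos c * Complex.I) = c + s * Complex.I := by
    rw [Complex.exp_mul_I, ← Complex.ofReal_cos, ← Complex.ofReal_sin,
      Real.cos_arccos (by linarith) hc1, Real.sin_arccos]
  have hexp' : Complex.exp (-(Real.arccos c * Complex.I)) = c - s * Complex.I := by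
    rw [← neg_mul, Complex.exp_mul_I, Complex.cos_neg, Complex.sin_neg, ← Complex.ofReal_cos,
      ← Complex.ofReal_sin, Real.cos_arccos (by linarith) hc1, Real.sin_arccos]
    ring
  rw [hexp, hexp']
  by_cases hs : s = 0
  · have hc1' : c = 1 := by
      rw [hs] at hs2
      nlinarith
    have hρB : ρ * (1 - V) = 0 := by
      have h1 : ρ * (1 - V) * (ρ * (1 - V))ᴴ = 0 := by
        rw [conjTranspose_mul, hρh, Matrix.mul_assoc, ← Matrix.mul_assoc (1 - V), hsq,
          ← Matrix.mul_assoc, Matrix.mul_sub, hρM, hc1', Matrix.mul_smul, Matrix.mul_one]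
        simp
      exact self_mul_conjTranspose_eq_zero.1 h1
    have hρV : ρ * V = ρ := by
      rw [Matrix.mul_sub, Matrix.mul_one, sub_eq_zero] at hρB
      exact hρB.symm
    refine ⟨ρ, ρ, hρ, hρ, fun _ => rfl, ?_, ?_⟩ <;> simp [hρV, hs, hc1']
  have hsC : (s : ℂ) ≠ 0 := by exact_mod_cast hs
  have hs2C : (s : ℂ) ^ 2 = 1 - (c : ℂ) ^ 2 := by exact_mod_cast hs2
  have hI : Complex.I ^ 2 = -1 := Complex.I_sq
  set H : Matrix n n ℂ := (-Complex.I / (2 * s)) • (V - Vᴴ) with hH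
  have hHh : Hᴴ = H := by
    rw [hH, conjTranspose_smul, conjTranspose_sub, conjTranspose_conjTranspose]
    have : star (-Complex.I / (2 * (s : ℂ))) = -(-Complex.I / (2 * s)) := by
      simp [neg_div]
    rw [this]
    module
  have hHV : H * V = V * H := by
    rw [hH, Matrix.smul_mul, Matrix.mul_smul, Matrix.sub_mul, Matrix.mul_sub, hV1, hV2]
  have hρV : ρ * V = (c : ℂ) • ρ + (s * Complex.I) • (ρ * H) := by
    have h1 : V = (1 / 2 : ℂ) • (V + Vᴴ) + (s * Complex.I) • H := by
      rw [hH, smul_smul]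
      have : (s : ℂ) * Complex.I * (-Complex.I / (2 * s)) = 1 / 2 := by
        field_simp; rw [hI]; ring
      rw [this]
      module
    nth_rewrite 1 [h1]
    rw [Matrix.mul_add, Matrix.mul_smul, Matrix.mul_smul, hρM, smul_smul]
    congr 2
    push_cast; ring
  have hρHH : ρ * H * H = ρ := by
    have h1 : (V - Vᴴ) * (V - Vᴴ) = (V + Vᴴ) * (V + Vᴴ) - (4 : ℂ) • (1 : Matrix n n ℂ) := by
      simp only [Matrix.mul_sub, Matrix.sub_mul, Matrix.mul_add, Matrix.add_mul, hV1, hV2]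
      module
    rw [Matrix.mul_assoc, hH, Matrix.smul_mul, Matrix.mul_smul, Matrix.mul_smul, Matrix.mul_smul,
      h1, Matrix.mul_sub, ← Matrix.mul_assoc, hρM, Matrix.smul_mul, hρM, Matrix.mul_smul,
      Matrix.mul_one]
    push_cast
    match_scalars
    field_simp
    rw [hI, hs2C]
    ring
  clear_value H
  have hdiag : ∀ i, ((ρ * H) i i).re = 0 := by
    intro i
    have h1 := him i
    have h2 : (ρ i i).im = 0 := (Complex.le_def.1 hρ.1.diag_nonneg).2.symm
    rw [hρV, Matrix.add_apply, Matrix.smul_apply, Matrix.smul_apply] at h1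
    simp [h2] at h1
    exact h1.resolve_left hs
  have hHρ : ∀ i, (H * ρ) i i + (ρ * H) i i = 0 := by
    intro i
    have h1 : (H * ρ) i i = star ((ρ * H) i i) := by
      rw [← conjTranspose_apply, conjTranspose_mul, hHh, hρh]
    rw [h1]
    refine Complex.ext ?_ ?_
    · simp [hdiag i]
    · simp
  -- `(1 + ε • H) / 2` acts on the range of `ρ` as the projection onto an eigenspace of `V`
  let R : ℂ → Matrix n n ℂ := fun ε => (1 / 2 : ℂ) • ((1 + ε • H) * ρ * (1 + ε • H))
  have hR : ∀ ε : ℂ, ε * ε = 1 →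
      R ε = (1 / 2 : ℂ) • (ρ + H * ρ * H) + (ε / 2) • (H * ρ + ρ * H) := by
    intro ε hε
    simp only [R, Matrix.mul_add, Matrix.add_mul, Matrix.one_mul, Matrix.mul_one, Matrix.smul_mul,
      Matrix.mul_smul]
    have : ε • (ρ * H + ε • (H * ρ * H)) = ε • (ρ * H) + H * ρ * H := by
      rw [smul_add, smul_smul, hε, one_smul]
    rw [this]
    module
  have hRd : ∀ ε : ℂ, ε * ε = 1 → ∀ i, R ε i i = 1 / 2 * (ρ + H * ρ * H) i i := by
    intro ε hε i
    rw [hR ε hε, Matrix.add_apply, Matrix.smul_apply, Matrix.smul_apply, Matrix.add_apply (H * ρ),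
      hHρ]
    simp
  have hRs : ∀ ε : ℂ, ε * ε = 1 → star ε = ε → IsState (R ε) := by
    intro ε hε hε'
    have hh : (1 + ε • H)ᴴ = 1 + ε • H := by
      rw [conjTranspose_add, conjTranspose_smul, conjTranspose_one, hHh, hε']
    refine ⟨?_, ?_⟩
    · have h1 := hρ.1.mul_mul_conjTranspose_same (1 + ε • H)
      rw [hh] at h1
      exact h1.smul (by rw [Complex.le_def]; norm_num)
    · have h1 : (R ε).trace = 1 / 2 * (ρ + H * ρ * H).trace := by
        simp only [trace, diag, Finset.mul_sum]
        exact Finset.sum_congr rfl fun i _ => hRd ε hε i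
      rw [h1, trace_add, Matrix.mul_assoc, Matrix.trace_mul_comm, hρHH, hρ.2]
      norm_num
  have hRV : ∀ ε : ℂ, ε * ε = 1 → R ε * V = (c + ε * (s * Complex.I)) • R ε := by
    intro ε hε
    have h1 : (1 + ε • H) * V = V * (1 + ε • H) := by
      rw [Matrix.add_mul, Matrix.mul_add, Matrix.smul_mul, Matrix.mul_smul, hHV, Matrix.one_mul,
        Matrix.mul_one]
    have h2 : ρ * H * (1 + ε • H) = ε • (ρ * (1 + ε • H)) := by
      rw [Matrix.mul_add, Matrix.mul_add, Matrix.mul_smul, Matrix.mul_smul, hρHH, smul_add,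
        smul_smul, hε, Matrix.mul_one, Matrix.mul_one, one_smul, add_comm]
    have h3 : ρ * (1 + ε • H) * V = (c + ε * (s * Complex.I)) • (ρ * (1 + ε • H)) := by
      rw [Matrix.mul_assoc, h1, ← Matrix.mul_assoc, hρV, Matrix.add_mul, Matrix.smul_mul,
        Matrix.smul_mul, h2]
      module
    simp only [R]
    rw [Matrix.smul_mul, Matrix.mul_assoc (1 + ε • H), Matrix.mul_assoc, h3, Matrix.mul_smul,
      smul_comm]
  refine ⟨R 1, R (-1), hRs 1 (by norm_num) (by simp), hRs (-1) (by norm_num) (by simp),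
    fun i => ?_, ?_, ?_⟩
  · rw [hRd 1 (by norm_num), hRd (-1) (by norm_num)]
  · rw [hRV 1 (by norm_num), one_mul]
  · rw [hRV (-1) (by norm_num)]
    congr 1; ring

end Eigenstates

/-! ### Attainment of the bound -/

section Attained

variable {n k : Type}

/-- The pure state whose amplitudes are the entries of `A`. -/
def pureState (A : Matrix n k ℂ) : Matrix (n × k) (n × k) ℂ :=
  vecMulVec (fun p => A p.1 p.2) (star fun p => A p.1 p.2)

/-- The matrix with the rows of `A` on the block diagonal, each as a column. -/
def blockRows [DecidableEq n] (A : Matrix n k ℂ) : Matrix (n × k) n ℂ :=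
  Matrix.of fun p j => if p.1 = j then A p.1 p.2 else 0

variable [Fintype n]

lemma isState_pureState [Fintype k] {A : Matrix n k ℂ} (hA : (A * Aᴴ).trace = 1) :
    IsState (pureState A) := by
  refine ⟨posSemidef_vecMulVec_self_star _, ?_⟩
  rw [← hA]
  simp [pureState, trace, diag, vecMulVec_apply, Fintype.sum_prod_type, mul_apply]

variable [DecidableEq n]

lemma conjTranspose_blockRows_mul [Fintype k] (A B : Matrix n k ℂ) :
    (blockRows A)ᴴ * blockRows B = diagonal fun i => (B * Aᴴ) i i := by
  ext i j
  rw [mul_apply, Fintype.sum_prod_type]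
  by_cases h : i = j
  · subst h
    rw [diagonal_apply_eq, mul_apply, Finset.sum_eq_single i]
    · simp [blockRows, mul_comm]
    · intro b _ hb; simp [blockRows, hb]
    · simp
  · rw [diagonal_apply_ne _ h]
    refine Finset.sum_eq_zero fun x _ => Finset.sum_eq_zero fun y _ => ?_
    by_cases hx : x = i
    · subst hx; simp [blockRows, h]
    · simp [blockRows, hx]

lemma ampliate_vonNeumann_pureState (V : Matrix n n ℂ) (A : Matrix n k ℂ) :
    ampliate k (vonNeumann V) (pureState A) =
      blockRows (Vᴴ * A) * (blockRows (Vᴴ * A))ᴴ := by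
  ext ⟨i, a⟩ ⟨j, b⟩
  rw [mul_apply]
  simp only [ampliate, vonNeumann, measureMap, LinearMap.coe_mk, AddHom.coe_mk, of_apply,
    blockRows, conjTranspose_apply]
  by_cases hij : i = j
  · subst hij
    rw [Finset.sum_eq_single i (fun x _ hx => by simp [Ne.symm hx]) (by simp), diagonal_apply_eq]
    simp only [if_true, mul_apply, trace, diag, of_apply, vonNeumannEffects, vecMulVec_apply,
      pureState, conjTranspose_apply, Pi.star_apply, star_sum, star_mul', star_star,
      Finset.sum_mul_sum]
    rw [Finset.sum_comm]
    refine Finset.sum_congr rfl fun x _ => Finset.sum_congr rfl fun y _ => ?_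
    ring
  · rw [diagonal_apply_ne _ hij]
    symm
    refine Finset.sum_eq_zero fun x _ => ?_
    by_cases hx : i = x
    · subst hx; simp [Ne.symm hij]
    · simp [hx]

/-- If the least fidelity is `c`, some input state makes the outputs of `P_W` and `P_1` as far from
each other as `c` permits. For `c > 0` this is the even mixture of the two eigenstates. -/
lemma exists_isState_le_traceNorm {W ρ : Matrix n n ℂ} (hU : Wᴴ * W = 1) (hρ : IsState ρ)
    (hmin : ∀ τ : Matrix n n ℂ, IsState τ → boxFidelity W ρ ≤ boxFidelity W τ) :
    ∃ ω : Matrix n n ℂ, IsState ω ∧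
      ∀ (k : Type) [Fintype k] [DecidableEq k] (A : Matrix n k ℂ), A * Aᴴ = ω →
        2 * √(1 - boxFidelity W ρ ^ 2) ≤
          traceNorm (ampliate k (vonNeumann W - vonNeumann 1) (pureState A)) := by
  have hU2 : W * Wᴴ = 1 := mul_eq_one_comm.1 hU
  rcases (boxFidelity_nonneg W ρ).eq_or_lt with h0 | hpos
  · refine ⟨ρ, hρ, fun k _ _ A hA => ?_⟩
    rw [ampliate_sub, ampliate_vonNeumann_pureState, ampliate_vonNeumann_pureState,
      conjTranspose_one, Matrix.one_mul]
    have hzero : ∀ i, (ρ * W) i i = 0 := fun i => norm_eq_zero.1 <|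
      (Finset.sum_eq_zero_iff_of_nonneg fun i _ => norm_nonneg ((ρ * W) i i)).1 h0.symm i
        (Finset.mem_univ i)
    have hKL : (blockRows (Wᴴ * A))ᴴ * blockRows A = 0 := by
      rw [conjTranspose_blockRows_mul, conjTranspose_mul, conjTranspose_conjTranspose,
        ← Matrix.mul_assoc, hA]
      simp only [hzero]
      exact diagonal_zero
    have htr : ∀ B : Matrix n k ℂ, (blockRows B * (blockRows B)ᴴ).trace = (B * Bᴴ).trace := by
      intro B
      rw [Matrix.trace_mul_comm, conjTranspose_blockRows_mul, trace_diagonal]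
      rfl
    rw [traceNorm_sub_of_mul_eq_zero (posSemidef_self_mul_conjTranspose _)
      (posSemidef_self_mul_conjTranspose _), trace_add, htr, htr, conjTranspose_mul,
      conjTranspose_conjTranspose, Matrix.mul_assoc, ← Matrix.mul_assoc A, hA,
      Matrix.trace_mul_comm, Matrix.mul_assoc, hU2, Matrix.mul_one, hρ.2, ← h0]
    · norm_num
    · rw [Matrix.mul_assoc, ← Matrix.mul_assoc _ (blockRows A), hKL]
      simp
  · obtain ⟨hc1, e, he, -, ρ₁, ρ₂, hρ₁, hρ₂, hd, h₁, h₂⟩ := exists_eigenstates hU hρ hmin hpos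
    rw [← vonNeumann_mul_diagonal W he]
    have hV1 : (W * diagonal e)ᴴ * (W * diagonal e) = 1 := 
      conjTranspose_mul_self_mul_diagonal hU he
    set c := boxFidelity W ρ
    have hc0 : 0 < c := hpos
    clear_value c
    set V := W * diagonal e
    clear_value V
    set z := Complex.exp (Real.arccos c * Complex.I) with hz
    have hz' : Complex.exp (-(Real.arccos c * Complex.I)) = star z := by
      rw [hz, RCLike.star_def, ← Complex.exp_conj]; simp
    have hzz : z * star z = 1 := by
      rw [← hz', hz, ← Complex.exp_add]; simp
    have hzc : z + star z = ((2 * c : ℝ) : ℂ) := by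
      rw [RCLike.star_def, Complex.add_conj, hz, Complex.exp_ofReal_mul_I_re,
        Real.cos_arccos (by linarith) hc1]
    rw [hz'] at h₂
    clear_value z
    -- the adjoint relations
    have h₁' : Vᴴ * ρ₁ = star z • ρ₁ := by
      have := congrArg conjTranspose h₁
      rwa [conjTranspose_mul, conjTranspose_smul, hρ₁.1.isHermitian.eq] at this
    have h₂' : Vᴴ * ρ₂ = z • ρ₂ := by
      have := congrArg conjTranspose h₂
      rwa [conjTranspose_mul, conjTranspose_smul, hρ₂.1.isHermitian.eq, star_star] at this
    refine ⟨(1 / 2 : ℂ) • (ρ₁ + ρ₂),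
      ⟨(hρ₁.1.add hρ₂.1).smul (by rw [Complex.le_def]; norm_num), ?_⟩,
      fun k _ _ A hA => ?_⟩
    · rw [trace_smul, trace_add, hρ₁.2, hρ₂.2]; norm_num
    set ω := (1 / 2 : ℂ) • (ρ₁ + ρ₂) with hω
    have hωd : ∀ i, ω i i = ρ₁ i i := fun i => by
      rw [hω, Matrix.smul_apply, Matrix.add_apply, ← hd, smul_eq_mul]; ring
    have hconj : Vᴴ * ω * V = ω := by
      rw [hω, Matrix.mul_smul, Matrix.smul_mul, Matrix.mul_add, h₁', h₂', Matrix.add_mul,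
        Matrix.smul_mul, Matrix.smul_mul, h₁, h₂, smul_smul, smul_smul, mul_comm (star z), hzz,
        one_smul, one_smul]
    have hl : ∀ i, (Vᴴ * ω) i i = c * ω i i := by
      intro i
      rw [hωd, hω, Matrix.mul_smul, Matrix.mul_add, h₁', h₂', Matrix.smul_apply, Matrix.add_apply,
        Matrix.smul_apply, Matrix.smul_apply, ← hd, smul_eq_mul, smul_eq_mul, smul_eq_mul,
        ← add_mul, add_comm, hzc]
      push_cast; ring
    have hr : ∀ i, (ω * V) i i = c * ω i i := by
      intro i
      rw [hωd, hω, Matrix.smul_mul, Matrix.add_mul, h₁, h₂, Matrix.smul_apply, Matrix.add_apply,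
        Matrix.smul_apply, Matrix.smul_apply, ← hd, smul_eq_mul, smul_eq_mul, smul_eq_mul,
        ← add_mul, hzc]
      push_cast; ring
    rw [ampliate_sub, ampliate_vonNeumann_pureState, ampliate_vonNeumann_pureState,
      conjTranspose_one, Matrix.one_mul]
    have hsm : (diagonal fun i => (c : ℂ) * ω i i) = (c : ℂ) • diagonal fun i => ω i i := by
      rw [← diagonal_smul]; rfl
    refine traceNorm_sub_of_gram (G := diagonal fun i => ω i i) (by nlinarith) ?_ ?_ ?_ ?_ ?_
    · rw [conjTranspose_blockRows_mul, conjTranspose_mul, conjTranspose_conjTranspose,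
        Matrix.mul_assoc, ← Matrix.mul_assoc A, hA, ← Matrix.mul_assoc, hconj]
    · rw [conjTranspose_blockRows_mul, hA]
    · rw [conjTranspose_blockRows_mul, conjTranspose_mul, conjTranspose_conjTranspose,
        ← Matrix.mul_assoc, hA, ← hsm]
      simp only [hr]
    · rw [conjTranspose_blockRows_mul, Matrix.mul_assoc, hA, ← hsm]
      simp only [hl]
    · rw [trace_diagonal]
      have : ∑ i, ω i i = ρ₁.trace := Finset.sum_congr rfl fun i _ => hωd i
      rw [this, hρ₁.2]

end Attained

/-! ### Binary discrimination of states -/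

section Helstrom

variable {n : Type} [Fintype n] [DecidableEq n]

lemma guessProb_eq {T : Bool → Matrix n n ℂ} (hT : IsPOVM T) {σ τ : Matrix n n ℂ}
    (hσ : IsState σ) (hτ : IsState τ) :
    guessProb T σ τ = 1 / 2 + 1 / 4 * ((T true - T false) * (σ - τ)).trace.re := by
  have h1 : T true + T false = 1 := by simpa using hT.2
  have h2 : ((T true + T false) * (σ + τ)).trace.re = 2 := by
    rw [h1, Matrix.one_mul, trace_add, hσ.2, hτ.2]; norm_num
  simp only [Matrix.add_mul, Matrix.mul_add, Matrix.sub_mul, Matrix.mul_sub, trace_add, trace_sub,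
    Complex.add_re, Complex.sub_re] at h2 ⊢
  rw [guessProb]
  linarith

/-- Helstrom's bound. -/
lemma guessProb_le {T : Bool → Matrix n n ℂ} (hT : IsPOVM T) {σ τ : Matrix n n ℂ}
    (hσ : IsState σ) (hτ : IsState τ) :
    guessProb T σ τ ≤ 1 / 2 + 1 / 4 * traceNorm (σ - τ) := by
  rw [guessProb_eq hT hσ hτ]
  have h1 : T false = 1 - T true := by
    rw [eq_sub_iff_add_eq, add_comm]; simpa using hT.2
  have hp := hT.1 true
  have hq := hT.1 false
  rw [h1] at hq ⊢
  have hh : (T true)ᴴ = T true := hp.isHermitian.eq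
  -- `1 - (2 T - 1) ^ 2 = 4 (T (1 - T) T + (1 - T) T (1 - T))`
  have hM : (1 - (T true - (1 - T true)) * (T true - (1 - T true))ᴴ).PosSemidef := by
    have e : 1 - (T true - (1 - T true)) * (T true - (1 - T true))ᴴ =
        (4 : ℂ) • (T true * (1 - T true) * (T true)ᴴ +
          (1 - T true) * T true * (1 - T true)ᴴ) := by
      simp only [conjTranspose_sub, conjTranspose_one, hh, Matrix.mul_sub, Matrix.sub_mul,
        Matrix.mul_one, Matrix.one_mul]
      module
    rw [e]
    exact ((hq.mul_mul_conjTranspose_same _).add (hp.mul_mul_conjTranspose_same _)).smul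
      (by rw [Complex.le_def]; norm_num)
  linarith [trace_mul_le_traceNorm hM (σ - τ)]

/-- Helstrom's measurement. -/
lemma exists_guessProb_eq {σ τ : Matrix n n ℂ} (hσ : IsState σ) (hτ : IsState τ) :
    ∃ T : Bool → Matrix n n ℂ, IsPOVM T ∧
      guessProb T σ τ = 1 / 2 + 1 / 4 * traceNorm (σ - τ) := by
  obtain ⟨M, hM, hMM, hMX⟩ :=
    exists_hermitian_traceNorm (hσ.1.isHermitian.sub hτ.1.isHermitian)
  have key : ∀ ε : ℂ, star ε = ε → ε * ε = 1 →
      ((1 / 2 : ℂ) • (1 + ε • M)).PosSemidef := by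
    intro ε hε hε1
    have e : (1 / 2 : ℂ) • (1 + ε • M) = (1 / 4 : ℂ) • ((1 + ε • M) * (1 + ε • M)ᴴ) := by
      have hsq : (ε • M) * (ε • M) = 1 := by rw [smul_mul_smul_comm, hε1, hMM, one_smul]
      rw [conjTranspose_add, conjTranspose_one, conjTranspose_smul, hε, hM.eq, Matrix.mul_add,
        Matrix.add_mul, Matrix.add_mul, hsq]
      simp only [Matrix.one_mul, Matrix.mul_one]
      module
    rw [e]
    exact (posSemidef_self_mul_conjTranspose _).smul (by rw [Complex.le_def]; norm_num)
  let T : Bool → Matrix n n ℂ := fun b => (1 / 2 : ℂ) • (1 + (if b then (1 : ℂ) else -1) • M)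
  have hT : IsPOVM T := by
    refine ⟨fun b => key _ (by cases b <;> simp) (by cases b <;> simp), ?_⟩
    simp only [T, Fintype.sum_bool, if_true]
    simp only [Bool.false_eq_true, if_false]
    module
  refine ⟨T, hT, ?_⟩
  have e : T true - T false = M := by
    simp only [T, if_true, Bool.false_eq_true, if_false]
    module
  rw [guessProb_eq hT hσ hτ, e, hMX]

end Helstrom

/-! ### The diamond norm and the parallel scheme -/

section Diamond

variable {n k : Type} [Fintype n] [Fintype k] [DecidableEq n] [DecidableEq k]

lemma isState_ampliate_vonNeumann {V : Matrix n n ℂ} (hV : Vᴴ * V = 1)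
    {ρ : Matrix (n × k) (n × k) ℂ} (hρ : IsState ρ) :
    IsState (ampliate k (vonNeumann V) ρ) :=
  have hV' : V * Vᴴ = 1 := mul_eq_one_comm.1 hV
  ((angleLE_refl hρ).ampliate_vonNeumann hV'
    (posSemidef_add_conjTranspose_of_unitary hV')).isState.1

/-- The least fidelity bounds the distance of the outputs of `P_W` and `P_1`, for every ancilla. -/
lemma traceNorm_ampliate_sub_le {W ρ : Matrix n n ℂ} (hU : Wᴴ * W = 1)
    (hmin : ∀ τ : Matrix n n ℂ, IsState τ → boxFidelity W ρ ≤ boxFidelity W τ)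
    {X : Matrix (n × k) (n × k) ℂ} (hX : traceNorm X = 1) :
    traceNorm (ampliate k (vonNeumann W - vonNeumann 1) X) ≤ 2 * √(1 - boxFidelity W ρ ^ 2) := by
  have hU' : W * Wᴴ = 1 := mul_eq_one_comm.1 hU
  have bound : ∀ s : ℝ, boxFidelity W ρ ^ 2 ≤ s ^ 2 →
      √(4 - (2 * s) ^ 2) ≤ 2 * √(1 - boxFidelity W ρ ^ 2) := by
    intro s hs
    rw [show 2 * √(1 - boxFidelity W ρ ^ 2) = √(2 ^ 2 * (1 - boxFidelity W ρ ^ 2)) by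
      rw [Real.sqrt_mul (by norm_num), Real.sqrt_sq (by norm_num)]]
    exact Real.sqrt_le_sqrt (by nlinarith)
  rcases (boxFidelity_nonneg W ρ).eq_or_lt with h0 | hpos
  · obtain ⟨s, -, hs⟩ := traceNorm_ampliate_le hU' (posSemidef_add_conjTranspose_of_unitary hU') hX
    exact hs.trans (bound s (by rw [← h0]; nlinarith [sq_nonneg s]))
  · obtain ⟨e, he, hc⟩ := exists_phases hU hpos hmin
    have hV' := mul_eq_one_comm.1 (conjTranspose_mul_self_mul_diagonal hU he)
    obtain ⟨s, hcs, hs⟩ := traceNorm_ampliate_le hV' hc hX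
    rw [vonNeumann_mul_diagonal W he] at hs
    exact hs.trans (bound s (pow_le_pow_left₀ hpos.le hcs 2))

lemma traceNorm_of_isState {ρ : Matrix n n ℂ} (hρ : IsState ρ) : traceNorm ρ = 1 := by
  rw [traceNorm_of_posSemidef hρ.1, hρ.2, Complex.one_re]

lemma diamondNorm_vonNeumann_sub {W ρ : Matrix n n ℂ} (hU : Wᴴ * W = 1) (hρ : IsState ρ)
    (hmin : ∀ τ : Matrix n n ℂ, IsState τ → boxFidelity W ρ ≤ boxFidelity W τ) :
    diamondNorm (vonNeumann W - vonNeumann 1) = 2 * √(1 - boxFidelity W ρ ^ 2) := by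
  refine IsGreatest.csSup_eq ⟨?_, ?_⟩
  · obtain ⟨ω, hω, h⟩ := exists_isState_le_traceNorm hU hρ hmin
    obtain ⟨A, rfl⟩ := exists_eq_mul_conjTranspose_self hω.1
    have hX := traceNorm_of_isState (isState_pureState hω.2)
    exact ⟨pureState A, hX, le_antisymm (h n A rfl) (traceNorm_ampliate_sub_le hU hmin hX)⟩
  · rintro _ ⟨X, hX, rfl⟩
    exact traceNorm_ampliate_sub_le hU hmin hX

/-- A purification with an ancilla of dimension `card n` and the Helstrom measurement attain the
diamond-norm distance. -/
lemma exists_guessProb_ampliate {W ρ : Matrix n n ℂ} (hU : Wᴴ * W = 1) (hρ : IsState ρ)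
    (hmin : ∀ τ : Matrix n n ℂ, IsState τ → boxFidelity W ρ ≤ boxFidelity W τ) :
    ∃ (s : ℕ) (ω : Matrix (n × Fin s) (n × Fin s) ℂ)
      (T : Bool → Matrix (n × Fin s) (n × Fin s) ℂ), IsState ω ∧ IsPOVM T ∧
      1 / 2 + 1 / 4 * (2 * √(1 - boxFidelity W ρ ^ 2)) =
        guessProb T (ampliate (Fin s) (vonNeumann W) ω) (ampliate (Fin s) (vonNeumann 1) ω) := by
  obtain ⟨ω, hω, h⟩ := exists_isState_le_traceNorm hU hρ hmin
  obtain ⟨A, rfl⟩ := exists_eq_mul_conjTranspose_self hω.1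
  let f := Fintype.equivFin n
  let B : Matrix n (Fin (Fintype.card n)) ℂ := A.submatrix id f.symm
  have hB : B * Bᴴ = A * Aᴴ := by
    rw [conjTranspose_submatrix, submatrix_mul_equiv]; rfl
  have hs : IsState (pureState B) := isState_pureState (by rw [hB, hω.2])
  obtain ⟨T, hT, hTe⟩ := exists_guessProb_eq (isState_ampliate_vonNeumann hU hs)
    (isState_ampliate_vonNeumann (V := 1) (by simp) hs)
  refine ⟨Fintype.card n, pureState B, T, hs, hT, ?_⟩
  rw [hTe, ← ampliate_sub, le_antisymm (traceNorm_ampliate_sub_le hU hmin (traceNorm_of_isState hs))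
    (h _ B hB)]

end Diamond

/-! ### Product states and tensor powers -/

section TensorPow

variable {d : ℕ}

lemma conjTranspose_tensorPow_mul {U : Matrix (Fin d) (Fin d) ℂ} (hU : Uᴴ * U = 1) (N : ℕ) :
    (tensorPow N U)ᴴ * tensorPow N U = 1 := by
  ext i j
  have h1 : ((tensorPow N U)ᴴ * tensorPow N U) i j = ∏ a, (Uᴴ * U) (i a) (j a) := by
    simp only [mul_apply, conjTranspose_apply, tensorPow, of_apply]
    rw [Finset.prod_univ_sum, Fintype.piFinset_univ]
    refine Finset.sum_congr rfl fun k _ => ?_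
    rw [star_prod, Finset.prod_mul_distrib]
  rw [h1, hU]
  by_cases h : i = j
  · subst h; simp
  · obtain ⟨a, ha⟩ := Function.ne_iff.1 h
    rw [one_apply_ne h]
    exact Finset.prod_eq_zero (Finset.mem_univ a) (one_apply_ne ha)

lemma boxFidelity_tensorPow_mul_diagonal (U : Matrix (Fin d) (Fin d) ℂ) {e : Fin d → ℂ}
    (he : ∀ i, ‖e i‖ = 1) {N : ℕ} (ρ : Matrix (Fin N → Fin d) (Fin N → Fin d) ℂ) :
    boxFidelity (tensorPow N (U * diagonal e)) ρ = boxFidelity (tensorPow N U) ρ := by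
  have h1 : tensorPow N (U * diagonal e) =
      tensorPow N U * diagonal fun i => ∏ a, e (i a) := by
    ext i j
    simp [tensorPow, mul_diagonal, Finset.prod_mul_distrib]
  refine Finset.sum_congr rfl fun i _ => ?_
  rw [h1, ← Matrix.mul_assoc, mul_diagonal, norm_mul, norm_prod]
  simp [he]

/-- The tensor product of a matrix on the first factor and a matrix on the remaining factors. -/
def tensorCons {N : ℕ} (ρ : Matrix (Fin d) (Fin d) ℂ)
    (τ : Matrix (Fin N → Fin d) (Fin N → Fin d) ℂ) :
    Matrix (Fin (N + 1) → Fin d) (Fin (N + 1) → Fin d) ℂ :=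
  Matrix.of fun i j => ρ (i 0) (j 0) * τ (Fin.tail i) (Fin.tail j)

lemma posSemidef_tensorCons {N : ℕ} {ρ : Matrix (Fin d) (Fin d) ℂ}
    {τ : Matrix (Fin N → Fin d) (Fin N → Fin d) ℂ} (hρ : ρ.PosSemidef) (hτ : τ.PosSemidef) :
    (tensorCons ρ τ).PosSemidef :=
  (hρ.kronecker hτ).submatrix fun i : Fin (N + 1) → Fin d => (i 0, Fin.tail i)

lemma trace_tensorCons {N : ℕ} (ρ : Matrix (Fin d) (Fin d) ℂ)
    (τ : Matrix (Fin N → Fin d) (Fin N → Fin d) ℂ) :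
    (tensorCons ρ τ).trace = ρ.trace * τ.trace := by
  simp only [trace, diag, Finset.sum_mul_sum]
  rw [← Fintype.sum_prod_type', ← (Fin.consEquiv fun _ => Fin d).sum_comp]
  simp [tensorCons, Fin.consEquiv]

lemma tensorCons_mul_tensorPow {N : ℕ} (ρ V : Matrix (Fin d) (Fin d) ℂ)
    (τ : Matrix (Fin N → Fin d) (Fin N → Fin d) ℂ) (i : Fin (N + 1) → Fin d) :
    (tensorCons ρ τ * tensorPow (N + 1) V) i i =
      (ρ * V) (i 0) (i 0) * (τ * tensorPow N V) (Fin.tail i) (Fin.tail i) := by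
  simp only [mul_apply, Finset.sum_mul_sum]
  rw [← Fintype.sum_prod_type', ← (Fin.consEquiv fun _ => Fin d).sum_comp]
  refine Finset.sum_congr rfl fun p _ => ?_
  simp only [tensorCons, tensorPow, of_apply, Fin.consEquiv, Equiv.coe_fn_mk, Fin.cons_zero,
    Fin.tail_cons, Fin.prod_univ_succ, Fin.cons_succ]
  simp only [Fin.tail]
  ring

/-- Some state with the diagonal of the `N`-th tensor power of `diagonal δ` has overlap `z` with its
rotation by the `N`-th tensor power of `V`, in the same ratio to the diagonal for all outcomes. -/
def OverlapReachable (V : Matrix (Fin d) (Fin d) ℂ) (δ : Fin d → ℂ) (N : ℕ) (z : ℂ) : Prop :=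
  ∃ ρ : Matrix (Fin N → Fin d) (Fin N → Fin d) ℂ, ρ.PosSemidef ∧
    (∀ i, ρ i i = ∏ a, δ (i a)) ∧ ∀ i, (ρ * tensorPow N V) i i = z * ∏ a, δ (i a)

lemma overlapReachable_zero (V : Matrix (Fin d) (Fin d) ℂ) (δ : Fin d → ℂ) :
    OverlapReachable V δ 0 1 :=
  ⟨1, PosSemidef.one, by simp, by simp [tensorPow]⟩

lemma OverlapReachable.succ {V : Matrix (Fin d) (Fin d) ℂ} {δ : Fin d → ℂ} {N : ℕ} {z w : ℂ}
    (h : OverlapReachable V δ N z) {ρ : Matrix (Fin d) (Fin d) ℂ} (hρ : ρ.PosSemidef)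
    (hδ : ∀ i, ρ i i = δ i) (hV : ρ * V = w • ρ) : OverlapReachable V δ (N + 1) (w * z) := by
  obtain ⟨τ, hτ, hd, ho⟩ := h
  refine ⟨tensorCons ρ τ, posSemidef_tensorCons hρ hτ, fun i => ?_, fun i => ?_⟩
  · rw [tensorCons, of_apply, hδ, hd, Fin.prod_univ_succ]
    rfl
  · rw [tensorCons_mul_tensorPow, hV, ho, Matrix.smul_apply, hδ, Fin.prod_univ_succ, smul_eq_mul]
    simp only [Fin.tail]
    ring

lemma OverlapReachable.convex {V : Matrix (Fin d) (Fin d) ℂ} {δ : Fin d → ℂ} {N : ℕ} {z w : ℂ}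
    (hz : OverlapReachable V δ N z) (hw : OverlapReachable V δ N w) {t : ℝ} (ht0 : 0 ≤ t)
    (ht1 : t ≤ 1) : OverlapReachable V δ N (t * z + (1 - t) * w) := by
  obtain ⟨ρ, hρ, hρd, hρo⟩ := hz
  obtain ⟨τ, hτ, hτd, hτo⟩ := hw
  refine ⟨(t : ℂ) • ρ + ((1 - t : ℝ) : ℂ) • τ,
    (hρ.smul (by exact_mod_cast ht0)).add (hτ.smul (by exact_mod_cast sub_nonneg.2 ht1)),
    fun i => ?_, fun i => ?_⟩
  · simp only [Matrix.add_apply, Matrix.smul_apply, hρd, hτd, smul_eq_mul]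
    push_cast; ring
  · simp only [Matrix.add_mul, Matrix.smul_mul, Matrix.add_apply, Matrix.smul_apply, hρo, hτo,
      smul_eq_mul]
    push_cast; ring

lemma OverlapReachable.exists_isState {V : Matrix (Fin d) (Fin d) ℂ} {δ : Fin d → ℂ} {N : ℕ}
    {x : ℝ} (h : OverlapReachable V δ N x) (hx : 0 ≤ x) (hδ : ∑ i, δ i = 1) :
    ∃ ρ, IsState ρ ∧ boxFidelity (tensorPow N V) ρ = x := by
  obtain ⟨ρ, hρ, hd, ho⟩ := h
  have htr : ρ.trace = 1 := by
    simp only [trace, diag, hd]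
    rw [← Fintype.piFinset_univ, ← Finset.prod_univ_sum (fun _ => Finset.univ) fun _ => δ]
    simp [hδ]
  refine ⟨ρ, ⟨hρ, htr⟩, ?_⟩
  have h1 : ∀ i, ‖(ρ * tensorPow N V) i i‖ = x * (ρ i i).re := fun i => by
    rw [ho, ← hd, norm_mul, Complex.norm_real, Real.norm_of_nonneg hx]
    have h2 := Complex.le_def.1 (hρ.diag_nonneg (i := i))
    rw [← Complex.re_eq_norm.2 (by rw [Complex.le_def]; exact h2)]
  rw [boxFidelity, Finset.sum_congr rfl fun i _ => h1 i, ← Finset.mul_sum, ← Complex.re_sum]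
  change x * ρ.trace.re = x
  rw [htr, Complex.one_re, mul_one]

variable {V ρ₁ ρ₂ : Matrix (Fin d) (Fin d) ℂ} {δ : Fin d → ℂ} {θ : ℝ}

lemma overlapReachable_exp {ρ : Matrix (Fin d) (Fin d) ℂ} (hρ : ρ.PosSemidef)
    (hδ : ∀ i, ρ i i = δ i) {x : ℝ} (h : ρ * V = Complex.exp (x * Complex.I) • ρ) :
    ∀ N : ℕ, OverlapReachable V δ N (Complex.exp ((N * x : ℝ) * Complex.I))
  | 0 => by simpa using overlapReachable_zero V δ
  | N + 1 => by
    have := (overlapReachable_exp hρ hδ h N).succ hρ hδ h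
    rw [← Complex.exp_add] at this
    convert this using 2
    push_cast; ring

/-- The mean of two conjugate phases. -/
lemma OverlapReachable.cos {N : ℕ} {x : ℝ}
    (h₁ : OverlapReachable V δ N (Complex.exp (x * Complex.I)))
    (h₂ : OverlapReachable V δ N (Complex.exp (-x * Complex.I))) :
    OverlapReachable V δ N (Real.cos x : ℝ) := by
  have h := h₁.convex h₂ (t := 1 / 2) (by norm_num) (by norm_num)
  convert h using 1
  rw [Complex.ofReal_cos, Complex.cos]
  push_cast
  ring

/-- Once `N θ` exceeds `π / 2`, the overlap zero is reachable. When this happens for the first time,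
zero lies between `cos ((N + 1) θ)` and `cos ((N - 1) θ)`, which are reached by multiplying the
`N`-th power of either eigenstate by the same or by the other eigenstate. -/
lemma overlapReachable_of_pi_div_two_lt (hρ₁ : ρ₁.PosSemidef) (hρ₂ : ρ₂.PosSemidef)
    (hd₁ : ∀ i, ρ₁ i i = δ i) (hd₂ : ∀ i, ρ₂ i i = δ i)
    (h₁ : ρ₁ * V = Complex.exp (θ * Complex.I) • ρ₁)
    (h₂ : ρ₂ * V = Complex.exp (-(θ * Complex.I)) • ρ₂) (hθ0 : 0 ≤ θ) (hθ : θ ≤ Real.pi / 2) :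
    ∀ N : ℕ, Real.pi / 2 < N * θ → OverlapReachable V δ N 0
  | 0, h => by
    have := Real.pi_pos
    simp at h
    linarith
  | N + 1, h => by
    by_cases hN : Real.pi / 2 < N * θ
    · simpa using (overlapReachable_of_pi_div_two_lt hρ₁ hρ₂ hd₁ hd₂ h₁ h₂ hθ0 hθ N hN).succ
        hρ₁ hd₁ h₁
    · rw [not_lt] at hN
      push_cast at h
      have h₂' : ρ₂ * V = Complex.exp ((-θ : ℝ) * Complex.I) • ρ₂ := by
        rw [h₂]; congr 2; push_cast; ring
      have e₁ := overlapReachable_exp hρ₁ hd₁ h₁ N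
      have e₂ := overlapReachable_exp hρ₂ hd₂ h₂' N
      have hc : OverlapReachable V δ (N + 1) (Real.cos ((N + 1) * θ) : ℝ) := by
        refine OverlapReachable.cos ?_ ?_
        · convert e₁.succ hρ₁ hd₁ h₁ using 1
          rw [← Complex.exp_add]; congr 1; push_cast; ring
        · convert e₂.succ hρ₂ hd₂ h₂' using 1
          rw [← Complex.exp_add]; congr 1; push_cast; ring
      have hc' : OverlapReachable V δ (N + 1) (Real.cos ((N - 1) * θ) : ℝ) := by
        refine OverlapReachable.cos ?_ ?_
        · convert e₁.succ hρ₂ hd₂ h₂' using 1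
          rw [← Complex.exp_add]; congr 1; push_cast; ring
        · convert e₂.succ hρ₁ hd₁ h₁ using 1
          rw [← Complex.exp_add]; congr 1; push_cast; ring
      have hx : Real.cos ((N + 1) * θ) ≤ 0 :=
        Real.cos_nonpos_of_pi_div_two_le_of_le h.le (by nlinarith)
      have hy : 0 ≤ Real.cos ((N - 1) * θ) := by
        have : (0 : ℝ) ≤ N * θ := by positivity
        refine Real.cos_nonneg_of_neg_pi_div_two_le_of_le ?_ ?_ <;> nlinarith
      set x := Real.cos ((N + 1) * θ)
      set y := Real.cos ((N - 1) * θ)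
      rcases eq_or_lt_of_le (show x ≤ y by linarith) with hxy | hxy
      · have : x = 0 := by linarith
        rw [this] at hc
        simpa using hc
      · have hpos : 0 < y - x := by linarith
        have ht := hc.convex hc' (t := y / (y - x)) (by positivity)
          (by rw [div_le_one hpos]; linarith)
        convert ht using 1
        rw [← Complex.ofReal_one, ← Complex.ofReal_sub, ← Complex.ofReal_mul, ← Complex.ofReal_mul,
          ← Complex.ofReal_add, ← Complex.ofReal_zero]
        congr 1
        field_simp
        ring

end TensorPow

/-! ### Networks -/

section Network

variable {d N : ℕ}

lemma isState_output {U : Matrix (Fin d) (Fin d) ℂ} (hU : Uᴴ * U = 1) (W : Network d N) :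
    IsState (W.output (vonNeumann U)) ∧ IsState (W.output (vonNeumann 1)) :=
  have hU' : U * Uᴴ = 1 := mul_eq_one_comm.1 hU
  (angleLE_stateAfter W hU' (posSemidef_add_conjTranspose_of_unitary hU') N le_rfl).isState

/-- The distance of the outputs of a network is bounded through the least fidelity for the tensor
power. If the latter is zero, the bound is trivial. Otherwise the angle between the outputs is at
most `N` times the least angle `θ` for one box, while products of the two eigenstates for one box
show that the least fidelity for the tensor power is at most `cos (N θ)`. -/
lemma traceNorm_output_sub_le [Nonempty (Fin d)] {U : Matrix (Fin d) (Fin d) ℂ}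
    (hU : Uᴴ * U = 1) {ρN : Matrix (Fin N → Fin d) (Fin N → Fin d) ℂ}
    (hmin : ∀ τ : Matrix (Fin N → Fin d) (Fin N → Fin d) ℂ, IsState τ →
      boxFidelity (tensorPow N U) ρN ≤ boxFidelity (tensorPow N U) τ) (W : Network d N) :
    traceNorm (W.output (vonNeumann U) - W.output (vonNeumann 1)) ≤
      2 * √(1 - boxFidelity (tensorPow N U) ρN ^ 2) := by
  have hU' : U * Uᴴ = 1 := mul_eq_one_comm.1 hU
  have htwo : traceNorm (W.output (vonNeumann U) - W.output (vonNeumann 1)) ≤ 2 :=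
    (angleLE_stateAfter W hU' (posSemidef_add_conjTranspose_of_unitary hU') N
      le_rfl).traceNorm_sub_le_two
  have hzero : ∀ τ : Matrix (Fin N → Fin d) (Fin N → Fin d) ℂ, IsState τ →
      boxFidelity (tensorPow N U) τ = 0 → traceNorm (W.output (vonNeumann U) -
        W.output (vonNeumann 1)) ≤ 2 * √(1 - boxFidelity (tensorPow N U) ρN ^ 2) := by
    intro τ hτ h
    have h1 := hmin τ hτ
    rw [h] at h1
    rw [le_antisymm h1 (boxFidelity_nonneg _ _)]
    simpa using htwo
  obtain ⟨ρ, hρ, hρmin⟩ := exists_isState_boxFidelity_le U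
  rcases (boxFidelity_nonneg U ρ).eq_or_lt with h0 | hpos
  · cases N with
    | zero =>
      have : W.output (vonNeumann U) - W.output (vonNeumann 1) = 0 := sub_self W.init
      rw [this, traceNorm_of_posSemidef PosSemidef.zero]
      simp
    | succ N =>
      obtain ⟨τ, hτ, -⟩ := exists_isState_boxFidelity_le (1 : Matrix (Fin N → Fin d) _ ℂ)
      refine hzero (tensorCons ρ τ) ⟨posSemidef_tensorCons hρ.1 hτ.1, ?_⟩ ?_
      · rw [trace_tensorCons, hρ.2, hτ.2, mul_one]
      · refine Finset.sum_eq_zero fun i _ => ?_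
        have h1 := (Finset.sum_eq_zero_iff_of_nonneg fun i _ => norm_nonneg ((ρ * U) i i)).1
          h0.symm (i 0) (Finset.mem_univ _)
        rw [tensorCons_mul_tensorPow, norm_mul, h1, zero_mul]
  · obtain ⟨hc1, e, he, hc, ρ₁, ρ₂, hρ₁, hρ₂, hd, h₁, h₂⟩ := exists_eigenstates hU hρ hρmin hpos
    have hV' := mul_eq_one_comm.1 (conjTranspose_mul_self_mul_diagonal hU he)
    have hangle := angleLE_stateAfter W hV' hc N le_rfl
    rw [vonNeumann_mul_diagonal U he] at hangle
    set θ := Real.arccos (boxFidelity U ρ) with hθ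
    have hθ0 : 0 ≤ θ := Real.arccos_nonneg _
    have hθ1 : θ ≤ Real.pi / 2 := Real.arccos_le_pi_div_two.2 hpos.le
    have hδ : ∑ i, ρ₁ i i = 1 := hρ₁.2
    by_cases hN : Real.pi / 2 < N * θ
    · have hr := overlapReachable_of_pi_div_two_lt (δ := fun i => ρ₁ i i) hρ₁.1 hρ₂.1
        (fun _ => rfl) (fun i => (hd i).symm) h₁ h₂ hθ0 hθ1 N hN
      rw [← Complex.ofReal_zero] at hr
      obtain ⟨τ, hτ, hτ0⟩ := hr.exists_isState le_rfl hδ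
      rw [boxFidelity_tensorPow_mul_diagonal U he] at hτ0
      exact hzero τ hτ hτ0
    · rw [not_lt] at hN
      have h₂' : ρ₂ * (U * diagonal e) = Complex.exp ((-θ : ℝ) * Complex.I) • ρ₂ := by
        rw [h₂]; congr 2; push_cast; ring
      have e₁ := overlapReachable_exp (δ := fun i => ρ₁ i i) hρ₁.1 (fun _ => rfl) h₁ N
      have e₂ := overlapReachable_exp (δ := fun i => ρ₁ i i) hρ₂.1 (fun i => (hd i).symm) h₂' N
      have hcos : 0 ≤ Real.cos (N * θ) := Real.cos_nonneg_of_neg_pi_div_two_le_of_le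
        (by have : (0 : ℝ) ≤ N * θ := by positivity
            linarith [Real.pi_pos]) hN
      have hr : OverlapReachable (U * diagonal e) (fun i => ρ₁ i i) N (Real.cos (N * θ) : ℝ) := by
        refine OverlapReachable.cos e₁ ?_
        convert e₂ using 3
        push_cast; ring
      obtain ⟨τ, hτ, hτ0⟩ := hr.exists_isState hcos hδ
      rw [boxFidelity_tensorPow_mul_diagonal U he] at hτ0
      have hle := hmin τ hτ
      rw [hτ0] at hle
      refine (hangle.traceNorm_sub_le hN).trans ?_
      refine mul_le_mul_of_nonneg_left (Real.sqrt_le_sqrt ?_) (by norm_num)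
      have := pow_le_pow_left₀ (boxFidelity_nonneg (tensorPow N U) ρN) hle 2
      linarith

end Network

end QDisc

theorem mainTheorem1 (d N : ℕ) (hd : 0 < d) (U : Matrix (Fin d) (Fin d) ℂ)
    (hU : U ∈ Matrix.unitaryGroup (Fin d) ℂ) :
    -- every network does at most as well as the best parallel strategy
    (∃ pPar : ℝ, IsGreatest (QDisc.parallelProbs N U) pPar ∧
      pPar = 1 / 2 + 1 / 4 * QDisc.diamondNorm
        (QDisc.vonNeumann (QDisc.tensorPow N U) - QDisc.vonNeumann 1) ∧
      ∀ p ∈ QDisc.networkProbs N U, p ≤ pPar) ∧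
    -- the outputs of every network are at most at the parallel diamond-norm distance
    (∀ W : QDisc.Network d N,
      QDisc.traceNorm (W.output (QDisc.vonNeumann U) - W.output (QDisc.vonNeumann 1)) ≤
        QDisc.diamondNorm
          (QDisc.vonNeumann (QDisc.tensorPow N U) - QDisc.vonNeumann 1)) := by
  have : Nonempty (Fin d) := ⟨⟨0, hd⟩⟩
  have hU1 : Uᴴ * U = 1 := Matrix.mem_unitaryGroup_iff'.1 hU
  have hUN := QDisc.conjTranspose_tensorPow_mul hU1 N
  obtain ⟨ρ, hρ, hmin⟩ := QDisc.exists_isState_boxFidelity_le (QDisc.tensorPow N U)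
  have hnet := fun W : QDisc.Network d N => QDisc.traceNorm_output_sub_le hU1 hmin W
  rw [QDisc.diamondNorm_vonNeumann_sub hUN hρ hmin]
  refine ⟨⟨_, ⟨QDisc.exists_guessProb_ampliate hUN hρ hmin, ?_⟩, rfl, ?_⟩, hnet⟩
  · rintro _ ⟨s, ω, T, hω, hT, rfl⟩
    have h := QDisc.guessProb_le hT (QDisc.isState_ampliate_vonNeumann hUN hω)
      (QDisc.isState_ampliate_vonNeumann (V := 1) (by simp) hω)
    rw [← QDisc.ampliate_sub] at h
    linarith [QDisc.traceNorm_ampliate_sub_le hUN hmin (QDisc.traceNorm_of_isState hω)]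
  · rintro _ ⟨W, T, hT, rfl⟩
    have hs := QDisc.isState_output hU1 W
    linarith [QDisc.guessProb_le hT hs.1 hs.2, hnet W]
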